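/- **Setting.** Let $\mathbb{X}$ be a unital category (finitely complete, with zero morphisms, such that for all $X,Y$ every monomorphism into $X\times Y$ through which both $\iota_1=\langle 1_X,0\rangle\colon X\to X\times Y$ and $\iota_2=\langle 0,1_Y\rangle\colon Y\to X\times Y$ factor is an isomorphism). Suppose that $\mathbb{X}$ is regular (kernel pairs have coequalizers and regular epimorphisms are stable under pullback) and has all finite colimits. Let $\mathsf{CMON}[\mathbb{X}]$ be the category of internal commutative monoids in $\mathbb{X}$ and monoid morphisms, with forgetful functor $\mathcal{U}\colon\mathsf{CMON}[\mathbb{X}]\to\mathbb{X}$. **Theorem.** The functor $\mathcal{U}$ has a left adjoint. Let $\mathrm{CMon}\colon\mathbb{X}\to\mathsf{CMON}[\mathbb{X}]$ be any left adjoint of $\mathcal{U}$, with unit $\eta$ and counit $\epsilon$. Then: 1. For each $X$, the object $\mathrm{CMon}(X)$ is the coequalizer of $\iota_1,\iota_2\colon X\to X\times X$, by a morphism $\pi$ with $\pi\iota_1=\pi\iota_2=\eta_X$. 2. $\mathcal{U}$ is full (and faithful) and $\mathrm{CMon}$ preserves finite products. Write $\mathcal{L}=\mathcal{U}\circ\mathrm{CMon}$,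 let $+_X,0_X$ be the monoid structure of $\mathrm{CMon}(X)$, let $\nu_X=\mathcal{U}(\epsilon_{\mathrm{CMon}(X)})\colon\mathcal{L}\mathcal{L}(X)\cong\mathcal{L}(X)$, and let $\omega_{X,Y}\colon\mathcal{L}(X\times Y)\cong\mathcal{L}(X)\times\mathcal{L}(Y)$ be the canonical isomorphism. 3. $\mathbb{X}$ is a cartesian tangent category (in the sense of Cockett and Cruttwell, the tangent bundle functor preserving finite products) with the following structure $\mathbb{T}$. The tangent bundle functor is $\mathcal{T}(X)=X\times\mathcal{L}(X)=X\times\mathrm{CMon}(X)$, with projection $\mathsf{p}_X=\pi_1$. The pullback of two copies of $\mathsf{p}_X$ is $\mathcal{T}_2(X)=X\times(\mathcal{L}(X)\times\mathcal{L}(X))$, the sum is $\mathsf{s}_X=1_X\times +_X$, and the zero is $\mathsf{z}_X=\langle 1_X,0_X\rangle$ (suppressing the maps to the terminal object). The vertical lift is $$\ell_X=(1\times\omega_{X,\mathcal{L}(X)}^{-1})\circ(\langle 1_X,0_X\rangle\times\langle 0_X,\nu_X^{-1}\rangle).$$ The canonical flip is $$\mathsf{c}_X=(1\times\omega_{X,\mathcal{L}(X)}^{-1})\circ\tau\circ(1\times\omega_{X,\mathcal{L}(X)}),$$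 where $\tau$ interchanges the two middle factors of $(X\times\mathcal{L}(X))\times(\mathcal{L}(X)\times\mathcal{L}\mathcal{L}(X))$. 4. Let $\mathsf{DBUN}[(\mathbb{X},\mathbb{T})]$ be the category of differential bundles in $(\mathbb{X},\mathbb{T})$. Its objects are additive bundles $q\colon E\to X$ with a universal lift $\lambda\colon E\to\mathcal{T}(E)$, in the sense of Cockett and Cruttwell. Its morphisms are the linear bundle morphisms, that is, the pairs $(f\colon E\to E',\,g\colon X\to X')$ with $q'f=gq$ and $\lambda' f=\mathcal{T}(f)\lambda$. There is an equivalence of categories $\mathsf{DBUN}[(\mathbb{X},\mathbb{T})]\simeq\mathbb{X}\times\mathsf{CMON}[\mathbb{X}]$. 5. For every object $X$, let $\mathsf{DBUN}[(\mathbb{X},\mathbb{T})]_X$ be the category of differential bundles over $X$ and linear bundle morphisms with $g=1_X$. There is an equivalence of categories $\mathsf{DBUN}[(\mathbb{X},\mathbb{T})]_X\simeq\mathsf{CMON}[\mathbb{X}]$. -/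

import Mathlib

open CategoryTheory CategoryTheory.Limits MonoidalCategory CartesianMonoidalCategory

universe v u

noncomputable section

namespace UnitalTangent

/-! ### Unital categories -/

section Unital

variable {C : Type u} [Category.{v} C] [CartesianMonoidalCategory C] [HasZeroMorphisms C]

/-- The first quasi-injection `⟨1, 0⟩ : X ⟶ X × Y`. -/
def quasiInl (X Y : C) : X ⟶ X ⊗ Y := lift (𝟙 X) 0

/-- The second quasi-injection `⟨0, 1⟩ : Y ⟶ X × Y`. -/
def quasiInr (X Y : C) : Y ⟶ X ⊗ Y := lift 0 (𝟙 Y)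

variable (C) in
/-- A unital category: a finitely complete category with zero morphisms in which, for all `X`, `Y`,
the two quasi-injections into `X × Y` are jointly strongly epic, that is, every monomorphism
into `X × Y` through which both of them factor is an isomorphism. -/
class IsUnital : Prop extends HasFiniteLimits C where
  isIso_of_fac : ∀ {X Y M : C} (m : M ⟶ X ⊗ Y) (f : X ⟶ M) (g : Y ⟶ M), Mono m →
    f ≫ m = quasiInl X Y → g ≫ m = quasiInr X Y → IsIso m

end Unital

/-! ### Additive bundles -/

section Bundles

variable {C : Type u} [Category.{v} C]

/-- The `m`-th power of an endofunctor. -/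
def iter (F : C ⥤ C) : ℕ → (C ⥤ C)
  | 0 => 𝟭 C
  | m + 1 => iter F m ⋙ F

/-- The cospan of `n` copies of `q`; its limit is the pullback `E_n` of `n` copies of `q`. -/
abbrev copies {E X : C} (q : E ⟶ X) (n : ℕ) : WidePullbackShape (Fin n) ⥤ C :=
  WidePullbackShape.wideCospan X (fun _ : Fin n => E) (fun _ => q)

/-- The data of an additive bundle over `X`: the projection `q : E ⟶ X`, a choice of the
pullback `E₂` of two copies of `q` with its projections `ρ₁`, `ρ₂`, the sum and the zero. -/
structure AdditiveBundleData (X : C) where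
  E : C
  q : E ⟶ X
  E₂ : C
  ρ₁ : E₂ ⟶ E
  ρ₂ : E₂ ⟶ E
  add : E₂ ⟶ E
  zero : X ⟶ E

/-- The image of the data of an additive bundle under a functor. -/
@[simps]
def AdditiveBundleData.map {X : C} (A : AdditiveBundleData X) (F : C ⥤ C) :
    AdditiveBundleData (F.obj X) where
  E := F.obj A.E
  q := F.map A.q
  E₂ := F.obj A.E₂
  ρ₁ := F.map A.ρ₁
  ρ₂ := F.map A.ρ₂
  add := F.map A.add
  zero := F.map A.zero

/-- The axioms of an additive bundle. Associativity, unitality and commutativity are stated for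
generalized elements `W ⟶ E` lying in the same fibre; for `W = E₃`, `E`, `E₂` and the universal
elements these are the usual diagrams. -/
structure AdditiveBundleData.IsAdditiveBundle {X : C} (A : AdditiveBundleData X) : Prop where
  hasPowers : ∀ n : ℕ, HasLimit (copies A.q n)
  isPullback : IsPullback A.ρ₁ A.ρ₂ A.q A.q
  add_proj : A.add ≫ A.q = A.ρ₁ ≫ A.q
  zero_proj : A.zero ≫ A.q = 𝟙 X
  add_assoc : ∀ {W : C} (a b c : W ⟶ A.E) (hab : a ≫ A.q = b ≫ A.q) (hbc : b ≫ A.q = c ≫ A.q),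
    isPullback.lift (isPullback.lift a b hab ≫ A.add) c
        (by rw [Category.assoc, add_proj, isPullback.lift_fst_assoc, hab, hbc]) ≫ A.add =
      isPullback.lift a (isPullback.lift b c hbc ≫ A.add)
        (by rw [Category.assoc, add_proj, isPullback.lift_fst_assoc, hab]) ≫ A.add
  zero_add : ∀ {W : C} (a : W ⟶ A.E),
    isPullback.lift (a ≫ A.q ≫ A.zero) a
      (by rw [Category.assoc, Category.assoc, zero_proj, Category.comp_id]) ≫ A.add = a
  add_zero : ∀ {W : C} (a : W ⟶ A.E),
    isPullback.lift a (a ≫ A.q ≫ A.zero)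
      (by rw [Category.assoc, Category.assoc, zero_proj, Category.comp_id]) ≫ A.add = a
  add_comm : ∀ {W : C} (a b : W ⟶ A.E) (hab : a ≫ A.q = b ≫ A.q),
    isPullback.lift a b hab ≫ A.add = isPullback.lift b a hab.symm ≫ A.add

/-- `(f, g)` is an additive bundle morphism `A ⟶ B`. The morphism `f₂` is `⟨ρ₁ f, ρ₂ f⟩`. -/
structure IsAdditiveBundleMorphism {X Y : C} (A : AdditiveBundleData X) (B : AdditiveBundleData Y)
    (f : A.E ⟶ B.E) (g : X ⟶ Y) : Prop where
  proj : f ≫ B.q = A.q ≫ g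
  add : ∃ f₂ : A.E₂ ⟶ B.E₂, f₂ ≫ B.ρ₁ = A.ρ₁ ≫ f ∧ f₂ ≫ B.ρ₂ = A.ρ₂ ≫ f ∧
    A.add ≫ f = f₂ ≫ B.add
  zero : A.zero ≫ f = g ≫ B.zero

end Bundles

/-! ### Tangent structures -/

section Tangent

variable (C : Type u) [Category.{v} C]

/-- The data of a tangent structure: the tangent bundle functor `T`, the projection `p`,
a choice of the pullbacks `T₂ X` of two copies of `p` with their projections `ρ₁`, `ρ₂`,
the sum `s`, the zero `z`, the vertical lift `l` and the canonical flip `c`. -/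
structure TangentData where
  T : C ⥤ C
  p : T ⟶ 𝟭 C
  T₂ : C ⥤ C
  ρ₁ : T₂ ⟶ T
  ρ₂ : T₂ ⟶ T
  s : T₂ ⟶ T
  z : 𝟭 C ⟶ T
  l : T ⟶ T ⋙ T
  c : T ⋙ T ⟶ T ⋙ T

variable {C}

/-- The bundle `T X ⟶ X` with its sum and zero. -/
@[simps]
def TangentData.bundle (𝕋 : TangentData C) (X : C) : AdditiveBundleData X where
  E := 𝕋.T.obj X
  q := 𝕋.p.app X
  E₂ := 𝕋.T₂.obj X
  ρ₁ := 𝕋.ρ₁.app X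
  ρ₂ := 𝕋.ρ₂.app X
  add := 𝕋.s.app X
  zero := 𝕋.z.app X

variable (C) in
/-- A tangent structure on a category. -/
structure TangentStructure extends TangentData C where
  /-- `p`, `s`, `z` form an additive bundle over each object. -/
  isAdditiveBundle : ∀ X : C, (toTangentData.bundle X).IsAdditiveBundle
  /-- All powers of `T` preserve the pullbacks of copies of `p`. -/
  preservesPowers : ∀ (X : C) (m n : ℕ), PreservesLimit (copies (p.app X) n) (iter T m)
  /-- `(l, z)` is an additive bundle morphism from the bundle `T X` to the image of it by `T`. -/
  lift_additive : ∀ X : C, IsAdditiveBundleMorphism (toTangentData.bundle X)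
    ((toTangentData.bundle X).map T) (l.app X) (z.app X)
  lift_coassoc : ∀ X : C, l.app X ≫ l.app (T.obj X) = l.app X ≫ T.map (l.app X)
  /-- Universality of the vertical lift; `w` is `⟨ρ₁ l, ρ₂ z⟩ : T₂ X ⟶ T (T₂ X)`. -/
  lift_universal : ∀ X : C, ∃ w : T₂.obj X ⟶ T.obj (T₂.obj X),
    w ≫ T.map (ρ₁.app X) = ρ₁.app X ≫ l.app X ∧
    w ≫ T.map (ρ₂.app X) = ρ₂.app X ≫ z.app (T.obj X) ∧
    IsPullback (w ≫ T.map (s.app X)) (ρ₁.app X ≫ p.app X) (T.map (p.app X)) (z.app X)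
  flip_flip : ∀ X : C, c.app X ≫ c.app X = 𝟙 (T.obj (T.obj X))
  /-- The Yang--Baxter identity. -/
  flip_braid : ∀ X : C, T.map (c.app X) ≫ c.app (T.obj X) ≫ T.map (c.app X) =
    c.app (T.obj X) ≫ T.map (c.app X) ≫ c.app (T.obj X)
  /-- `(c, 1)` is an additive bundle morphism from the image by `T` of the bundle `T X`
  to the bundle `T (T X)` over `T X`. -/
  flip_additive : ∀ X : C, IsAdditiveBundleMorphism ((toTangentData.bundle X).map T)
    (toTangentData.bundle (T.obj X)) (c.app X) (𝟙 (T.obj X))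
  lift_flip : ∀ X : C, l.app X ≫ c.app X = l.app X
  lift_flip_flip : ∀ X : C, l.app (T.obj X) ≫ T.map (c.app X) ≫ c.app (T.obj X) =
    c.app X ≫ T.map (l.app X)

/-- A tangent structure on a category with finite products is cartesian if `T` preserves them. -/
def TangentStructure.IsCartesian (𝕋 : TangentStructure C) : Prop :=
  PreservesFiniteProducts 𝕋.T

end Tangent

/-! ### Differential bundles -/

section DifferentialBundles

variable {C : Type u} [Category.{v} C]

/-- A differential bundle over `X` in a tangent category. -/
structure DifferentialBundleOver (𝕋 : TangentStructure C) (X : C) extends AdditiveBundleData X where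
  /-- The lift. -/
  lam : E ⟶ 𝕋.T.obj E
  isAdditiveBundle : toAdditiveBundleData.IsAdditiveBundle
  preservesPowers : ∀ m n : ℕ, PreservesLimit (copies q n) (iter 𝕋.T m)
  lift_additive_zero : IsAdditiveBundleMorphism toAdditiveBundleData
    (toAdditiveBundleData.map 𝕋.T) lam (𝕋.z.app X)
  lift_additive : IsAdditiveBundleMorphism toAdditiveBundleData (𝕋.bundle E) lam zero
  lift_coassoc : lam ≫ 𝕋.T.map lam = lam ≫ 𝕋.l.app E
  /-- Universality of the lift; `w` is `⟨ρ₁ lam, ρ₂ z⟩ : E₂ ⟶ T E₂`. All powers of `T` preserve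
  the pullback square (for `m = 0` it is the square itself). -/
  lift_universal : ∃ w : E₂ ⟶ 𝕋.T.obj E₂,
    w ≫ 𝕋.T.map ρ₁ = ρ₁ ≫ lam ∧
    w ≫ 𝕋.T.map ρ₂ = ρ₂ ≫ 𝕋.z.app E ∧
    ∀ m : ℕ, IsPullback ((iter 𝕋.T m).map (w ≫ 𝕋.T.map add)) ((iter 𝕋.T m).map (ρ₁ ≫ q))
      ((iter 𝕋.T m).map (𝕋.T.map q)) ((iter 𝕋.T m).map (𝕋.z.app X))

/-- A linear bundle morphism over `X`. -/
@[ext]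
structure DifferentialBundleOver.Hom {𝕋 : TangentStructure C} {X : C}
    (A B : DifferentialBundleOver 𝕋 X) where
  hom : A.E ⟶ B.E
  proj : hom ≫ B.q = A.q
  lift : A.lam ≫ 𝕋.T.map hom = hom ≫ B.lam

/-- The category of differential bundles over `X`. -/
instance (𝕋 : TangentStructure C) (X : C) : Category (DifferentialBundleOver 𝕋 X) where
  Hom A B := A.Hom B
  id A := { hom := 𝟙 A.E, proj := by simp, lift := by simp }
  comp f g :=
    { hom := f.hom ≫ g.hom
      proj := by rw [Category.assoc, g.proj, f.proj]
      lift := by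
        rw [Functor.map_comp, ← Category.assoc, f.lift, Category.assoc, g.lift, Category.assoc] }
  id_comp _ := DifferentialBundleOver.Hom.ext (Category.id_comp _)
  comp_id _ := DifferentialBundleOver.Hom.ext (Category.comp_id _)
  assoc _ _ _ := DifferentialBundleOver.Hom.ext (Category.assoc _ _ _)

/-- A differential bundle: a base object and a differential bundle over it. -/
structure DifferentialBundle (𝕋 : TangentStructure C) where
  base : C
  bundle : DifferentialBundleOver 𝕋 base

/-- A linear bundle morphism `(f, g)`. -/
@[ext]
structure DifferentialBundle.Hom {𝕋 : TangentStructure C} (A B : DifferentialBundle 𝕋) where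
  hom : A.bundle.E ⟶ B.bundle.E
  base : A.base ⟶ B.base
  proj : hom ≫ B.bundle.q = A.bundle.q ≫ base
  lift : A.bundle.lam ≫ 𝕋.T.map hom = hom ≫ B.bundle.lam

/-- The category of differential bundles. -/
instance (𝕋 : TangentStructure C) : Category (DifferentialBundle 𝕋) where
  Hom A B := A.Hom B
  id A := { hom := 𝟙 A.bundle.E, base := 𝟙 A.base, proj := by simp, lift := by simp }
  comp f g :=
    { hom := f.hom ≫ g.hom
      base := f.base ≫ g.base
      proj := by rw [Category.assoc, g.proj, ← Category.assoc, f.proj, Category.assoc]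
      lift := by
        rw [Functor.map_comp, ← Category.assoc, f.lift, Category.assoc, g.lift, Category.assoc] }
  id_comp _ := DifferentialBundle.Hom.ext (Category.id_comp _) (Category.id_comp _)
  comp_id _ := DifferentialBundle.Hom.ext (Category.comp_id _) (Category.comp_id _)
  assoc _ _ _ := DifferentialBundle.Hom.ext (Category.assoc _ _ _) (Category.assoc _ _ _)

end DifferentialBundles

/-! ### Linear assignments and their tangent structure -/

section LinearAssignments

variable (C : Type u) [Category.{v} C] [CartesianMonoidalCategory C] [BraidedCategory C]

/-- A linear assignment: a finite product preserving endofunctor `L`, a commutative monoid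
structure on each `L X`, natural in `X`, and a natural isomorphism `ν : L L X ≅ L X` of
commutative monoids with `ν_{L X} = L ν_X`. -/
structure LinearAssignment where
  L : C ⥤ C
  preservesFiniteProducts : PreservesFiniteProducts L
  mon : ∀ X : C, MonObj (L.obj X)
  comm : ∀ X : C, IsCommMonObj (L.obj X)
  isMonHom_map : ∀ {X Y : C} (f : X ⟶ Y), IsMonHom (L.map f)
  ν : L ⋙ L ≅ L
  isMonHom_ν : ∀ X : C, IsMonHom (M := L.obj (L.obj X)) (N := L.obj X) (ν.hom.app X)
  ν_obj : ∀ X : C, ν.hom.app (L.obj X) = L.map (ν.hom.app X)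

attribute [instance] LinearAssignment.preservesFiniteProducts LinearAssignment.mon
  LinearAssignment.comm LinearAssignment.isMonHom_map

variable {C}

namespace LinearAssignment

variable (𝓛 : LinearAssignment C)

/-- The sum `L X × L X ⟶ L X`. -/
def add (X : C) : 𝓛.L.obj X ⊗ 𝓛.L.obj X ⟶ 𝓛.L.obj X := MonObj.mul

/-- The zero `Y ⟶ * ⟶ L X`. -/
def zero (Y X : C) : Y ⟶ 𝓛.L.obj X := toUnit Y ≫ MonObj.one

/-- The comparison isomorphism `L (X × Y) ⟶ L X × L Y`. -/
abbrev ω (X Y : C) : 𝓛.L.obj (X ⊗ Y) ⟶ 𝓛.L.obj X ⊗ 𝓛.L.obj Y :=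
  CartesianMonoidalCategory.prodComparison 𝓛.L X Y

@[simp] theorem zero_map {Y X X' : C} (f : X ⟶ X') :
    𝓛.zero Y X ≫ 𝓛.L.map f = 𝓛.zero Y X' := by
  simp [zero, IsMonHom.one_hom]

@[simp] theorem comp_zero {Z Y X : C} (f : Z ⟶ Y) : f ≫ 𝓛.zero Y X = 𝓛.zero Z X := by
  simp [zero]

theorem add_map {X Y : C} (f : X ⟶ Y) :
    𝓛.add X ≫ 𝓛.L.map f = (𝓛.L.map f ⊗ₘ 𝓛.L.map f) ≫ 𝓛.add Y :=
  IsMonHom.mul_hom _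

theorem ν_inv_naturality {X Y : C} (f : X ⟶ Y) :
    𝓛.ν.inv.app X ≫ 𝓛.L.map (𝓛.L.map f) = 𝓛.L.map f ≫ 𝓛.ν.inv.app Y :=
  (𝓛.ν.inv.naturality f).symm

/-- `T X = X × L X`. -/
@[simps]
def tangent : C ⥤ C where
  obj X := X ⊗ 𝓛.L.obj X
  map f := f ⊗ₘ 𝓛.L.map f

/-- `T₂ X = X × (L X × L X)`. -/
@[simps]
def tangent₂ : C ⥤ C where
  obj X := X ⊗ (𝓛.L.obj X ⊗ 𝓛.L.obj X)
  map f := f ⊗ₘ (𝓛.L.map f ⊗ₘ 𝓛.L.map f)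

/-- The vertical lift `X × L X ⟶ (X × L X) × L (X × L X)`: the composite of
`⟨1, 0⟩ × ⟨0, ν⁻¹⟩ : X × L X ⟶ (X × L X) × (L X × L L X)` with `1 × ω⁻¹`. -/
def vlift (X : C) : X ⊗ 𝓛.L.obj X ⟶ (X ⊗ 𝓛.L.obj X) ⊗ 𝓛.L.obj (X ⊗ 𝓛.L.obj X) :=
  (lift (𝟙 X) (𝓛.zero X X) ⊗ₘ lift (𝓛.zero (𝓛.L.obj X) X) (𝓛.ν.inv.app X)) ≫
    (X ⊗ 𝓛.L.obj X) ◁ inv (𝓛.ω X (𝓛.L.obj X))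

/-- The canonical flip: the interchange of the two middle factors of
`(X × L X) × (L X × L L X)`, conjugated by `1 × ω`. -/
def flip (X : C) : (X ⊗ 𝓛.L.obj X) ⊗ 𝓛.L.obj (X ⊗ 𝓛.L.obj X) ⟶
    (X ⊗ 𝓛.L.obj X) ⊗ 𝓛.L.obj (X ⊗ 𝓛.L.obj X) :=
  (X ⊗ 𝓛.L.obj X) ◁ 𝓛.ω X (𝓛.L.obj X) ≫
    tensorμ X (𝓛.L.obj X) (𝓛.L.obj X) (𝓛.L.obj (𝓛.L.obj X)) ≫
      (X ⊗ 𝓛.L.obj X) ◁ inv (𝓛.ω X (𝓛.L.obj X))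

theorem whisker_inv_ω_naturality {X Y : C} (f : X ⟶ Y) :
    (X ⊗ 𝓛.L.obj X) ◁ inv (𝓛.ω X (𝓛.L.obj X)) ≫
        ((f ⊗ₘ 𝓛.L.map f) ⊗ₘ 𝓛.L.map (f ⊗ₘ 𝓛.L.map f)) =
      ((f ⊗ₘ 𝓛.L.map f) ⊗ₘ (𝓛.L.map f ⊗ₘ 𝓛.L.map (𝓛.L.map f))) ≫
        (Y ⊗ 𝓛.L.obj Y) ◁ inv (𝓛.ω Y (𝓛.L.obj Y)) := by
  have h := CartesianMonoidalCategory.prodComparison_inv_natural 𝓛.L f (𝓛.L.map f)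
  simp only [← id_tensorHom, tensorHom_comp_tensorHom, h, Category.id_comp, Category.comp_id]

theorem whisker_ω_naturality {X Y : C} (f : X ⟶ Y) :
    ((f ⊗ₘ 𝓛.L.map f) ⊗ₘ 𝓛.L.map (f ⊗ₘ 𝓛.L.map f)) ≫ (Y ⊗ 𝓛.L.obj Y) ◁ 𝓛.ω Y (𝓛.L.obj Y) =
      (X ⊗ 𝓛.L.obj X) ◁ 𝓛.ω X (𝓛.L.obj X) ≫
        ((f ⊗ₘ 𝓛.L.map f) ⊗ₘ (𝓛.L.map f ⊗ₘ 𝓛.L.map (𝓛.L.map f))) := by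
  have h := CartesianMonoidalCategory.prodComparison_natural 𝓛.L f (𝓛.L.map f)
  simp only [← id_tensorHom, tensorHom_comp_tensorHom, h, Category.id_comp, Category.comp_id]

theorem vlift_naturality {X Y : C} (f : X ⟶ Y) :
    (f ⊗ₘ 𝓛.L.map f) ≫ 𝓛.vlift Y =
      𝓛.vlift X ≫ ((f ⊗ₘ 𝓛.L.map f) ⊗ₘ 𝓛.L.map (f ⊗ₘ 𝓛.L.map f)) := by
  rw [vlift, vlift, Category.assoc, whisker_inv_ω_naturality]
  simp only [← Category.assoc]
  congr 1
  rw [tensorHom_comp_tensorHom, tensorHom_comp_tensorHom]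
  congr 1
  · ext <;> simp
  · ext
    · simp
    · simp

theorem flip_naturality {X Y : C} (f : X ⟶ Y) :
    ((f ⊗ₘ 𝓛.L.map f) ⊗ₘ 𝓛.L.map (f ⊗ₘ 𝓛.L.map f)) ≫ 𝓛.flip Y =
      𝓛.flip X ≫ ((f ⊗ₘ 𝓛.L.map f) ⊗ₘ 𝓛.L.map (f ⊗ₘ 𝓛.L.map f)) := by
  simp only [flip, Category.assoc]
  rw [whisker_inv_ω_naturality, ← Category.assoc, whisker_ω_naturality, Category.assoc,
    tensorμ_natural_assoc]

theorem proj₁_naturality {X Y : C} (f : X ⟶ Y) :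
    (f ⊗ₘ (𝓛.L.map f ⊗ₘ 𝓛.L.map f)) ≫ Y ◁ fst (𝓛.L.obj Y) (𝓛.L.obj Y) =
      X ◁ fst (𝓛.L.obj X) (𝓛.L.obj X) ≫ (f ⊗ₘ 𝓛.L.map f) := by
  simp only [← id_tensorHom, tensorHom_comp_tensorHom, tensorHom_fst, Category.id_comp,
    Category.comp_id]

theorem proj₂_naturality {X Y : C} (f : X ⟶ Y) :
    (f ⊗ₘ (𝓛.L.map f ⊗ₘ 𝓛.L.map f)) ≫ Y ◁ snd (𝓛.L.obj Y) (𝓛.L.obj Y) =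
      X ◁ snd (𝓛.L.obj X) (𝓛.L.obj X) ≫ (f ⊗ₘ 𝓛.L.map f) := by
  simp only [← id_tensorHom, tensorHom_comp_tensorHom, tensorHom_snd, Category.id_comp,
    Category.comp_id]

theorem sum_naturality {X Y : C} (f : X ⟶ Y) :
    (f ⊗ₘ (𝓛.L.map f ⊗ₘ 𝓛.L.map f)) ≫ Y ◁ 𝓛.add Y =
      X ◁ 𝓛.add X ≫ (f ⊗ₘ 𝓛.L.map f) := by
  simp only [← id_tensorHom, tensorHom_comp_tensorHom, add_map, Category.id_comp,
    Category.comp_id]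

theorem zero_naturality {X Y : C} (f : X ⟶ Y) :
    f ≫ lift (𝟙 Y) (𝓛.zero Y Y) = lift (𝟙 X) (𝓛.zero X X) ≫ (f ⊗ₘ 𝓛.L.map f) := by
  ext <;> simp

/-- The data of the tangent structure induced by a linear assignment. -/
def tangentData : TangentData C where
  T := 𝓛.tangent
  p := { app X := fst X (𝓛.L.obj X)
         naturality _ _ f := tensorHom_fst f (𝓛.L.map f) }
  T₂ := 𝓛.tangent₂
  ρ₁ := { app X := X ◁ fst (𝓛.L.obj X) (𝓛.L.obj X)
          naturality _ _ f := 𝓛.proj₁_naturality f }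
  ρ₂ := { app X := X ◁ snd (𝓛.L.obj X) (𝓛.L.obj X)
          naturality _ _ f := 𝓛.proj₂_naturality f }
  s := { app X := X ◁ 𝓛.add X
         naturality _ _ f := 𝓛.sum_naturality f }
  z := { app X := lift (𝟙 X) (𝓛.zero X X)
         naturality _ _ f := 𝓛.zero_naturality f }
  l := { app X := 𝓛.vlift X
         naturality _ _ f := 𝓛.vlift_naturality f }
  c := { app X := 𝓛.flip X
         naturality _ _ f := 𝓛.flip_naturality f }

end LinearAssignment

/-- A left adjoint of the forgetful functor `CMON[C] ⥤ C` is a linear reflector if that functor is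
full (it is always faithful), so that `CMON[C]` may be viewed as a full subcategory, and the left
adjoint preserves finite products. -/
structure IsLinearReflector {R : C ⥤ CommMon C} (adj : R ⊣ CommMon.forget C) : Prop where
  full : (CommMon.forget C).Full
  preservesFiniteProducts : PreservesFiniteProducts R

/-- The linear assignment `X ↦ CMon X` induced by a linear reflector `CMon : C ⥤ CMON[C]`; its
isomorphism `ν` is given by the counit, and the monoid structure of `L X` is that of `CMon X`. -/
def LinearAssignment.ofReflector {R : C ⥤ CommMon C} (adj : R ⊣ CommMon.forget C)
    (h : IsLinearReflector adj) : LinearAssignment C :=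
  have := h.full
  have := h.preservesFiniteProducts
  have := adj.rightAdjoint_preservesLimits
  { L := R ⋙ CommMon.forget C
    preservesFiniteProducts := inferInstance
    mon := fun X => (R.obj X).mon
    comm := fun X => (R.obj X).comm
    isMonHom_map := fun f => (R.map f).hom.isMonHom_hom
    ν := NatIso.ofComponents
      (fun X => (CommMon.forget C).mapIso (asIso (adj.counit.app (R.obj X))))
      (fun f => by
        exact congrArg (CommMon.forget C).map (adj.counit.naturality (R.map f)))
    isMonHom_ν := fun X => (adj.counit.app (R.obj X)).hom.isMonHom_hom
    ν_obj := fun X => by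
      have key := adj.counit.naturality (adj.counit.app (R.obj X))
      exact congrArg (CommMon.forget C).map ((cancel_mono _).1 key).symm }

end LinearAssignments

end UnitalTangent

end

set_option linter.unusedSectionVars false

noncomputable section

namespace UnitalTangent

open scoped MonObj

/-! ### Monoids in unital categories -/

section ZeroMorphisms

variable {C : Type u} [Category.{v} C] [CartesianMonoidalCategory C] [HasZeroMorphisms C]

/-! In a unital category the quasi-injections `ι₁`, `ι₂` into a product are jointly epic
(`hom_ext_quasiInj`), so equalities of maps out of `X × Y` can be tested on the two axes. Hence an
operation with neutral element zero is automatically associative and commutative, and every morphism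
between monoids is a monoid morphism; so the forgetful functor is full. The reflection of `X` is
obtained by identifying the two axes of `X × X`. If `π` is the coequalizer and `e` its restriction
to an axis, then `e` is an extremal epimorphism, so by regularity `e × e` is a regular epimorphism,
and `π` descends along it to an operation (`exists_mul_of_isColimit`). Since the unit `e` is epic,
the reflector preserves products: the inverse of `L(X × Y) → LX × LY` is `(a, b) ↦ L(ι₁)a + L(ι₂)b`.

For the tangent structure, a point of `T²X` has coordinates `(x, a; b, c)`; the flip exchanges `a`
and `b`, and the lift is `(x, a) ↦ (x, 0; 0, ν⁻¹a)`. All bundles involved are product projections,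
so the pullbacks in the axioms are products, preserved by every power of `T`, and the equations are
checked coordinatewise. The same computation shows that `X × M → X` is a differential bundle
whenever a suitable isomorphism `e : M ≅ LM` is given; the unit is one for every monoid.

Conversely, the vertical component `E → LE` of the lift of a differential bundle `q` lands in the
kernel `K` of `L q`, a commutative monoid. Universality makes `E → X × K` invertible
(`isIso_lift_of_universal`), and coassociativity makes it linear. A linear map between product
bundles is a product `g × f`, because its fibre component vanishes on `X × 0`. So `(X, M) ↦ X × M`
is an equivalence. -/

theorem eq_zero_of_tensorUnit {X : C} (f : 𝟙_ C ⟶ X) : f = 0 := by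
  rw [← Category.id_comp f, toUnit_unique (𝟙 (𝟙_ C)) 0, zero_comp]

@[simp]
theorem one_eq_zero (M : C) [MonObj M] : η[M] = 0 := eq_zero_of_tensorUnit _

theorem lift_zero_left_comp_mul {W M : C} [MonObj M] (f : W ⟶ M) : lift 0 f ≫ μ[M] = f := by
  simpa using MonObj.lift_comp_one_left (toUnit W) f

theorem lift_zero_right_comp_mul {W M : C} [MonObj M] (f : W ⟶ M) : lift f 0 ≫ μ[M] = f := by
  simpa using MonObj.lift_comp_one_right f (toUnit W)

theorem comp_quasiInl {W X Y : C} (f : W ⟶ X) : f ≫ quasiInl X Y = lift f 0 := by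
  simp [quasiInl]

theorem comp_quasiInr {W X Y : C} (f : W ⟶ Y) : f ≫ quasiInr X Y = lift 0 f := by
  simp [quasiInr]

theorem quasiInl_tensorHom {X Y X' Y' : C} (f : X ⟶ X') (g : Y ⟶ Y') :
    quasiInl X Y ≫ (f ⊗ₘ g) = f ≫ quasiInl X' Y' := by
  simp [quasiInl, lift_map]

theorem quasiInr_tensorHom {X Y X' Y' : C} (f : X ⟶ X') (g : Y ⟶ Y') :
    quasiInr X Y ≫ (f ⊗ₘ g) = g ≫ quasiInr X' Y' := by
  simp [quasiInr, lift_map]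

theorem quasiInl_mul (M : C) [MonObj M] : quasiInl M M ≫ μ[M] = 𝟙 M :=
  lift_zero_right_comp_mul _

theorem quasiInr_mul (M : C) [MonObj M] : quasiInr M M ≫ μ[M] = 𝟙 M :=
  lift_zero_left_comp_mul _

end ZeroMorphisms

section Unital

variable {C : Type u} [Category.{v} C] [CartesianMonoidalCategory C] [HasZeroMorphisms C]
  [IsUnital C]

/-- The quasi-injections are jointly epic. -/
theorem hom_ext_quasiInj {X Y Z : C} {f g : X ⊗ Y ⟶ Z} (hl : quasiInl X Y ≫ f = quasiInl X Y ≫ g)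
    (hr : quasiInr X Y ≫ f = quasiInr X Y ≫ g) : f = g := by
  -- The equalizer is a subobject containing both axes, hence everything.
  have : IsIso (equalizer.ι f g) := IsUnital.isIso_of_fac (equalizer.ι f g)
    (equalizer.lift _ hl) (equalizer.lift _ hr) inferInstance (by simp) (by simp)
  rw [← cancel_epi (equalizer.ι f g), equalizer.condition]

/-- In a unital category every morphism between monoids is a monoid morphism. -/
theorem isMonHom_of_isUnital {M N : C} [MonObj M] [MonObj N] (f : M ⟶ N) : IsMonHom f where
  one_hom := by simp
  mul_hom := by
    apply hom_ext_quasiInj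
    · rw [← Category.assoc, quasiInl_mul, Category.id_comp, ← Category.assoc, quasiInl_tensorHom,
        Category.assoc, quasiInl_mul, Category.comp_id]
    · rw [← Category.assoc, quasiInr_mul, Category.id_comp, ← Category.assoc, quasiInr_tensorHom,
        Category.assoc, quasiInr_mul, Category.comp_id]

/-- A binary operation with neutral element zero is a monoid structure. -/
@[reducible]
def monObjOfMul {M : C} (m : M ⊗ M ⟶ M) (hl : quasiInl M M ≫ m = 𝟙 M)
    (hr : quasiInr M M ≫ m = 𝟙 M) : MonObj M where
  one := 0
  mul := m
  one_mul := by
    rw [← cancel_epi (λ_ M).inv, Iso.inv_hom_id, ← hr, ← Category.assoc]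
    congr 1
    ext <;> simp [quasiInr]
  mul_one := by
    rw [← cancel_epi (ρ_ M).inv, Iso.inv_hom_id, ← hl, ← Category.assoc]
    congr 1
    ext <;> simp [quasiInl]
  mul_assoc := by
    have hl' {W : C} (f : W ⟶ M) : lift f 0 ≫ m = f := by
      rw [← comp_quasiInl, Category.assoc, hl, Category.comp_id]
    have hr' {W : C} (f : W ⟶ M) : lift 0 f ≫ m = f := by
      rw [← comp_quasiInr, Category.assoc, hr, Category.comp_id]
    have e : (α_ M M M).hom ≫ M ◁ m =
        lift (fst _ _ ≫ fst _ _) (lift (fst _ _ ≫ snd _ _) (snd _ _) ≫ m) := by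
      ext
      · simp
      · rw [Category.assoc, whiskerLeft_snd, lift_snd, ← Category.assoc]
        congr 1
        ext <;> simp
    rw [← Category.assoc, e]
    -- Two axes suffice: on `M × M` both sides reduce to `m`, on the last factor to the identity.
    apply hom_ext_quasiInj
    · have e1 : quasiInl (M ⊗ M) M ≫ m ▷ M = lift m 0 := by ext <;> simp [quasiInl]
      rw [← Category.assoc, e1, hl', ← Category.assoc, comp_lift, ← Category.assoc, ← Category.assoc,
        comp_lift]
      simp [quasiInl, hl']
    · have e1 : quasiInr (M ⊗ M) M ≫ m ▷ M = lift 0 (𝟙 _) := by ext <;> simp [quasiInr]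
      rw [← Category.assoc, e1, hr', ← Category.assoc, comp_lift, ← Category.assoc, ← Category.assoc,
        comp_lift]
      simp [quasiInr, hr']

/-- In a unital category every monoid is commutative. -/
theorem isCommMonObj_of_isUnital [BraidedCategory C] (M : C) [MonObj M] : IsCommMonObj M where
  mul_comm := by
    apply hom_ext_quasiInj
    · have : quasiInl M M ≫ (β_ M M).hom = quasiInr M M := by
        ext <;> simp [quasiInl, quasiInr]
      rw [← Category.assoc, this, quasiInr_mul, quasiInl_mul]
    · have : quasiInr M M ≫ (β_ M M).hom = quasiInl M M := by
        ext <;> simp [quasiInl, quasiInr]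
      rw [← Category.assoc, this, quasiInr_mul, quasiInl_mul]

/-- The commutative monoid given by a binary operation with neutral element zero. -/
def commMonOfMul [BraidedCategory C] {M : C} (m : M ⊗ M ⟶ M) (hl : quasiInl M M ≫ m = 𝟙 M)
    (hr : quasiInr M M ≫ m = 𝟙 M) : CommMon C :=
  letI := monObjOfMul m hl hr
  haveI := isCommMonObj_of_isUnital M
  { X := M }

/-- A morphism between the underlying objects of commutative monoids in a unital category, as a
morphism of commutative monoids. -/
def commMonHom [BraidedCategory C] {M N : CommMon C} (f : M.X ⟶ N.X) : M ⟶ N :=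
  CommMon.homMk { hom := f, isMonHom_hom := isMonHom_of_isUnital f }

instance forget_full [BraidedCategory C] : (CommMon.forget C).Full where
  map_surjective f := ⟨commMonHom f, rfl⟩

end Unital

/-! ### Functors into monoids -/

section Pointed

variable {C : Type u} [Category.{v} C] [CartesianMonoidalCategory C] [HasZeroMorphisms C]
  [IsUnital C] {L : C ⥤ C} [∀ X, MonObj (L.obj X)] {u : ∀ X, X ⟶ L.obj X} [∀ X, Epi (u X)]

theorem map_zero_of_epi (hu : ∀ {X Y : C} (f : X ⟶ Y), u X ≫ L.map f = f ≫ u Y) (X Y : C) :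
    L.map (0 : X ⟶ Y) = 0 := by
  rw [← cancel_epi (u X), hu, zero_comp, comp_zero]

theorem isIso_terminalComparison_of_epi (e : 𝟙_ C ⟶ L.obj (𝟙_ C)) [Epi e] :
    IsIso (CartesianMonoidalCategory.terminalComparison L) := by
  refine ⟨0, ?_, toUnit_unique _ _⟩
  rw [← cancel_epi e, eq_zero_of_tensorUnit e, zero_comp, zero_comp]

/-- The inverse is `(a, b) ↦ L(ι₁)a + L(ι₂)b`. One composite is tested on the axes of `LX × LY`; the
other is first precomposed with the epic unit, then tested on the axes of `X × Y`. -/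
theorem isIso_prodComparison_of_epi
    (hu : ∀ {X Y : C} (f : X ⟶ Y), u X ≫ L.map f = f ≫ u Y) (X Y : C) :
    IsIso (CartesianMonoidalCategory.prodComparison L X Y) := by
  have ml : quasiInl (L.obj X) (L.obj Y) ≫
      (L.map (quasiInl X Y) ⊗ₘ L.map (quasiInr X Y)) ≫ μ = L.map (quasiInl X Y) := by
    rw [← Category.assoc, quasiInl_tensorHom, Category.assoc, quasiInl_mul, Category.comp_id]
  have mr : quasiInr (L.obj X) (L.obj Y) ≫
      (L.map (quasiInl X Y) ⊗ₘ L.map (quasiInr X Y)) ≫ μ = L.map (quasiInr X Y) := by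
    rw [← Category.assoc, quasiInr_tensorHom, Category.assoc, quasiInr_mul, Category.comp_id]
  have cl : L.map (quasiInl X Y) ≫ CartesianMonoidalCategory.prodComparison L X Y =
      quasiInl _ _ := by
    ext <;> simp [← L.map_comp, quasiInl, map_zero_of_epi hu]
  have cr : L.map (quasiInr X Y) ≫ CartesianMonoidalCategory.prodComparison L X Y =
      quasiInr _ _ := by
    ext <;> simp [← L.map_comp, quasiInr, map_zero_of_epi hu]
  refine ⟨(L.map (quasiInl X Y) ⊗ₘ L.map (quasiInr X Y)) ≫ μ, ?_, ?_⟩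
  · rw [← cancel_epi (u (X ⊗ Y)), Category.comp_id]
    apply hom_ext_quasiInj
    · rw [← Category.assoc, ← hu, Category.assoc, ← Category.assoc (L.map _), cl, ml]
    · rw [← Category.assoc, ← hu, Category.assoc, ← Category.assoc (L.map _), cr, mr]
  · apply hom_ext_quasiInj
    · rw [← Category.assoc, ml, cl, Category.comp_id]
    · rw [← Category.assoc, mr, cr, Category.comp_id]

/-- A functor to monoids with a pointwise epic unit preserves finite products. -/
theorem preservesFiniteProducts_of_epi
    (hu : ∀ {X Y : C} (f : X ⟶ Y), u X ≫ L.map f = f ≫ u Y) : PreservesFiniteProducts L := by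
  have := isIso_terminalComparison_of_epi (u (𝟙_ C))
  have := isIso_prodComparison_of_epi hu
  have := preservesLimit_empty_of_isIso_terminalComparison L
  have := preservesLimitsOfShape_pempty_of_preservesTerminal L
  have := preservesLimitsOfShape_discrete_walkingPair_of_isIso_prodComparison L
  exact PreservesFiniteProducts.of_preserves_binary_and_terminal L

end Pointed

/-! ### The reflection -/

section Reflection

variable {C : Type u} [Category.{v} C] [CartesianMonoidalCategory C] [HasZeroMorphisms C]
  [IsUnital C]

/-! ### The coequalizer of the quasi-injections -/

section Coequalizer

variable {X L : C} {π : X ⊗ X ⟶ L} {w : quasiInl X X ≫ π = quasiInr X X ≫ π}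

/-- The common restriction of the coequalizer of the quasi-injections is an extremal
epimorphism. -/
theorem extremalEpi_of_isColimit (hπ : IsColimit (Cofork.ofπ π w)) :
    ExtremalEpi (quasiInl X X ≫ π) := by
  have hepi : Epi π := Cofork.IsColimit.epi hπ
  have : Epi (quasiInl X X ≫ π) := ⟨fun g h e => by
    rw [← cancel_epi π]
    apply hom_ext_quasiInj
    · simpa using e
    · simpa [w] using e⟩
  refine ⟨fun {Z} p i hpi hi => ?_⟩
  -- The pullback of `i` along `π` contains both axes of `X × X`, so `π` factors through `i`.
  have : IsIso (pullback.fst π i) := IsUnital.isIso_of_fac (pullback.fst π i)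
    (pullback.lift (quasiInl X X) p hpi.symm) (pullback.lift (quasiInr X X) p (by rw [← w, hpi]))
    inferInstance (pullback.lift_fst _ _ _) (pullback.lift_fst _ _ _)
  have : StrongEpi π := by
    have : IsRegularEpi π := ⟨⟨⟨_, _, _, w, hπ⟩⟩⟩
    infer_instance
  have h : (inv (pullback.fst π i) ≫ pullback.snd π i) ≫ i = π := by
    simp [← pullback.condition]
  have : StrongEpi i := by
    have : StrongEpi ((inv (pullback.fst π i) ≫ pullback.snd π i) ≫ i) := by rwa [h]
    exact strongEpi_of_strongEpi (inv (pullback.fst π i) ≫ pullback.snd π i) i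
  exact isIso_of_mono_of_strongEpi i

/-- Factor `f × g` as `f × 1` followed by `1 × g`: these are pullbacks of `f` and `g` along
projections, and in a regular category extremal epimorphisms are regular, hence stable. -/
theorem tensorHom_extremalEpi [Regular C] {X' Y Y' : C} (f : X ⟶ X') (g : Y ⟶ Y')
    [ExtremalEpi f] [ExtremalEpi g] : IsRegularEpi (f ⊗ₘ g) := by
  have h1 : IsPullback (fst X Y) (f ▷ Y) f (fst X' Y) :=
    { w := by simp
      isLimit' := ⟨PullbackCone.IsLimit.mk _ (fun s => lift s.fst (s.snd ≫ snd _ _))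
        (by simp) (fun s => by ext <;> simp [s.condition])
        (fun s m h1 h2 => by ext <;> simp [h1, ← h2])⟩ }
  have h2 : IsPullback (snd X' Y) (X' ◁ g) g (snd X' Y') :=
    { w := by simp
      isLimit' := ⟨PullbackCone.IsLimit.mk _ (fun s => lift (s.snd ≫ fst _ _) s.fst)
        (by simp) (fun s => by ext <;> simp [s.condition])
        (fun s m h1 h2 => by ext <;> simp [h1, ← h2])⟩ }
  have i1 : IsRegularEpi (f ▷ Y) := Regular.regularEpiIsStableUnderBaseChange.of_isPullback h1
    (inferInstanceAs (IsRegularEpi f))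
  have i2 : IsRegularEpi (X' ◁ g) := Regular.regularEpiIsStableUnderBaseChange.of_isPullback h2
    (inferInstanceAs (IsRegularEpi g))
  have : StrongEpi (f ⊗ₘ g) := by
    rw [MonoidalCategory.tensorHom_def]
    exact strongEpi_comp _ _
  infer_instance

variable [Regular C]

/-- The operation on the coequalizer of the quasi-injections. -/
theorem exists_mul_of_isColimit (hπ : IsColimit (Cofork.ofπ π w)) :
    ∃ m : L ⊗ L ⟶ L, quasiInl L L ≫ m = 𝟙 L ∧ quasiInr L L ≫ m = 𝟙 L := by
  let e := quasiInl X X ≫ π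
  have he : ExtremalEpi e := extremalEpi_of_isColimit hπ
  have hee : IsRegularEpi (e ⊗ₘ e) := tensorHom_extremalEpi e e
  let r := IsRegularEpi.getStruct (e ⊗ₘ e)
  have h1 : (pullback.fst e e ⊗ₘ pullback.fst e e) ≫ π =
      (pullback.snd e e ⊗ₘ pullback.snd e e) ≫ π := by
    have hl (f : pullback e e ⟶ X) : quasiInl _ _ ≫ (f ⊗ₘ f) ≫ π = f ≫ e := by
      rw [← Category.assoc, quasiInl_tensorHom, Category.assoc]
    have hr (f : pullback e e ⟶ X) : quasiInr _ _ ≫ (f ⊗ₘ f) ≫ π = f ≫ e := by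
      rw [← Category.assoc, quasiInr_tensorHom, Category.assoc, ← w]
    apply hom_ext_quasiInj
    · rw [hl, hl, pullback.condition]
    · rw [hr, hr, pullback.condition]
  -- The pair presenting `e × e` need not be its kernel pair, but both coordinates factor through
  -- the kernel pair of `e`, where `h1` applies.
  have h2 : r.left ≫ π = r.right ≫ π := by
    have c1 : (r.left ≫ fst _ _) ≫ e = (r.right ≫ fst _ _) ≫ e := by
      simpa using r.w =≫ fst _ _
    have c2 : (r.left ≫ snd _ _) ≫ e = (r.right ≫ snd _ _) ≫ e := by
      simpa using r.w =≫ snd _ _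
    have := lift (pullback.lift _ _ c1) (pullback.lift _ _ c2) ≫= h1
    rw [← Category.assoc, ← Category.assoc, lift_map, lift_map] at this
    simpa only [pullback.lift_fst, pullback.lift_snd, lift_comp_fst_snd] using this
  let m : L ⊗ L ⟶ L := Cofork.IsColimit.desc r.isColimit π h2
  have hm : (e ⊗ₘ e) ≫ m = π := Cofork.IsColimit.π_desc' r.isColimit π h2
  refine ⟨m, ?_, ?_⟩
  · rw [← cancel_epi e, Category.comp_id, ← Category.assoc, ← quasiInl_tensorHom e e,
      Category.assoc, hm]
  · rw [← cancel_epi e, Category.comp_id, ← Category.assoc, ← quasiInr_tensorHom e e,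
      Category.assoc, hm, ← w]

/-- The universal property of the coequalizer of the quasi-injections among monoids. -/
theorem exists_desc_of_isColimit (hπ : IsColimit (Cofork.ofπ π w)) {M : C} [MonObj M]
    (f : X ⟶ M) : ∃ g : L ⟶ M, (quasiInl X X ≫ π) ≫ g = f := by
  -- The map `(x, y) ↦ f x + f y` restricts to `f` on both axes.
  have h : quasiInl X X ≫ (f ⊗ₘ f) ≫ μ = quasiInr X X ≫ (f ⊗ₘ f) ≫ μ := by
    rw [← Category.assoc, quasiInl_tensorHom, Category.assoc, quasiInl_mul, ← Category.assoc,
      quasiInr_tensorHom, Category.assoc, quasiInr_mul]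
  refine ⟨Cofork.IsColimit.desc hπ _ h, ?_⟩
  have := Cofork.IsColimit.π_desc' hπ _ h
  rw [Cofork.π_ofπ] at this
  rw [Category.assoc, this, ← Category.assoc, quasiInl_tensorHom, Category.assoc, quasiInl_mul,
    Category.comp_id]

end Coequalizer

variable [BraidedCategory C] [Regular C] [HasFiniteColimits C]

/-- The coequalizer of the quasi-injections is a commutative monoid. -/
theorem exists_commMon_isColimit (X : C) :
    ∃ (M : CommMon C) (π : X ⊗ X ⟶ M.X) (w : quasiInl X X ≫ π = quasiInr X X ≫ π),
      Nonempty (IsColimit (Cofork.ofπ π w)) := by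
  have hπ : IsColimit (Cofork.ofπ (coequalizer.π (quasiInl X X) (quasiInr X X))
    (coequalizer.condition _ _)) := coequalizerIsCoequalizer _ _
  obtain ⟨m, hl, hr⟩ := exists_mul_of_isColimit hπ
  exact ⟨commMonOfMul m hl hr, _, _, ⟨hπ⟩⟩

/-- The forgetful functor from commutative monoids in a unital regular category with finite
colimits has a left adjoint. -/
theorem forget_isRightAdjoint : (CommMon.forget C).IsRightAdjoint := by
  rw [isRightAdjoint_iff_hasInitial_structuredArrow]
  intro X
  obtain ⟨M, π, w, ⟨hπ⟩⟩ := exists_commMon_isColimit X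
  let A : StructuredArrow X (CommMon.forget C) :=
    StructuredArrow.mk (Y := M) (f := (quasiInl X X ≫ π : X ⟶ (CommMon.forget C).obj M))
  have : Epi (quasiInl X X ≫ π) := (extremalEpi_of_isColimit hπ).toEpi
  have hsub (B : StructuredArrow X (CommMon.forget C)) : Subsingleton (A ⟶ B) := ⟨fun g h => by
    apply StructuredArrow.hom_ext
    apply (CommMon.forget C).map_injective
    exact (cancel_epi (quasiInl X X ≫ π)).1
      ((StructuredArrow.w g).trans (StructuredArrow.w h).symm)⟩
  have hne (B : StructuredArrow X (CommMon.forget C)) : Nonempty (A ⟶ B) := by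
    obtain ⟨g, hg⟩ := exists_desc_of_isColimit hπ (M := B.right.X) B.hom
    exact ⟨StructuredArrow.homMk (commMonHom g) hg⟩
  exact hasInitial_of_unique A

/-! ### An arbitrary left adjoint -/

section LeftAdjoint

variable {R : C ⥤ CommMon C} (adj : R ⊣ CommMon.forget C)

/-- The unit of the reflection to commutative monoids is the common restriction of the coequalizer
of the quasi-injections. -/
theorem exists_isColimit_unit (X : C) :
    ∃ (π : X ⊗ X ⟶ (R.obj X).X) (w : quasiInl X X ≫ π = quasiInr X X ≫ π),
      Nonempty (IsColimit (Cofork.ofπ π w)) ∧ quasiInl X X ≫ π = adj.unit.app X := by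
  obtain ⟨M, π, w, ⟨hπ⟩⟩ := exists_commMon_isColimit X
  have : Epi (quasiInl X X ≫ π) := (extremalEpi_of_isColimit hπ).toEpi
  obtain ⟨e, he⟩ : ∃ e : X ⟶ (R.obj X).X, e = adj.unit.app X := ⟨_, rfl⟩
  obtain ⟨g, hg⟩ := exists_desc_of_isColimit hπ e
  obtain ⟨h, k, hk, hh⟩ : ∃ (h : R.obj X ⟶ M) (k : (R.obj X).X ⟶ M.X),
      (CommMon.forget C).map h = k ∧ e ≫ k = quasiInl X X ≫ π :=
    ⟨(adj.homEquiv X M).symm (quasiInl X X ≫ π), _, rfl, by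
      rw [he]
      exact (adj.homEquiv_unit ..).symm.trans (Equiv.apply_symm_apply _ _)⟩
  have hkg : e ≫ k ≫ g = e := by rw [← Category.assoc, hh, hg]
  have hhg : h ≫ commMonHom g = 𝟙 _ := by
    apply (adj.homEquiv _ _).injective
    rw [adj.homEquiv_unit, adj.homEquiv_unit, Functor.map_comp, hk, ← he]
    exact hkg.trans (Category.comp_id e).symm
  let i : M.X ≅ (R.obj X).X :=
    { hom := g
      inv := k
      hom_inv_id := by
        rw [← cancel_epi (quasiInl X X ≫ π), ← Category.assoc, hg, hh, Category.comp_id]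
      inv_hom_id := hk ▸ congrArg (CommMon.forget C).map hhg }
  refine ⟨π ≫ g, by rw [← Category.assoc, w, Category.assoc],
    ⟨IsColimit.ofIsoColimit hπ (Cofork.ext i rfl)⟩, by rw [← Category.assoc, hg, he]⟩

theorem epi_unit (X : C) : Epi (adj.unit.app X) := by
  obtain ⟨π, w, ⟨hπ⟩, h⟩ := exists_isColimit_unit adj X
  exact h ▸ (extremalEpi_of_isColimit hπ).toEpi

/-- The epic unit gives preservation for the composite with the forgetful functor, which is full and
faithful and so reflects products. -/
theorem reflector_preservesFiniteProducts {R : C ⥤ CommMon C} (adj : R ⊣ CommMon.forget C) :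
    PreservesFiniteProducts R := by
  have (X : C) : MonObj ((R ⋙ CommMon.forget C).obj X) := (R.obj X).mon
  let e (X : C) : X ⟶ (R ⋙ CommMon.forget C).obj X := adj.unit.app X
  have (X : C) : Epi (e X) := epi_unit adj X
  have := preservesFiniteProducts_of_epi (L := R ⋙ CommMon.forget C) (u := e)
    fun f => (adj.unit.naturality f).symm
  have : ReflectsFiniteProducts (CommMon.forget C) := { reflects _ := inferInstance }
  exact preservesFiniteProducts_of_reflects_of_preserves R (CommMon.forget C)

/-- In a unital regular category with finite colimits, the left adjoint of the forgetful functor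
from commutative monoids is a linear reflector. -/
theorem isLinearReflector : IsLinearReflector adj where
  full := inferInstance
  preservesFiniteProducts := reflector_preservesFiniteProducts adj

end LeftAdjoint

end Reflection

/-! ### Limits of product projections -/

section ProductProjections

variable {C : Type u} [Category.{v} C]

/-- If every morphism of a wide cospan is a product projection, then a cone over it is a limit
as soon as its legs to the base and to the complementary factors form a product. -/
def isLimitOfProductLegs {J : Type} {K : WidePullbackShape J ⥤ C} {Y : Option J → C}
    (b : K.obj none ⟶ Y none) (hb : Mono b) (r : ∀ j, K.obj (some j) ⟶ Y (some j))
    (h : ∀ j, IsLimit (BinaryFan.mk (K.map (WidePullbackShape.Hom.term j)) (r j))) (t : Cone K)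
    (g : ∀ o, t.pt ⟶ Y o) (hg : IsLimit (Fan.mk t.pt g)) (hnone : g none = t.π.app none ≫ b)
    (hsome : ∀ j, g (some j) = t.π.app (some j) ≫ r j) : IsLimit t :=
  let legs (s : Cone K) : ∀ o, s.pt ⟶ Y o
    | none => s.π.app none ≫ b
    | some j => s.π.app (some j) ≫ r j
  have fac (s : Cone K) (o) : hg.lift (Fan.mk s.pt (legs s)) ≫ g o = legs s o :=
    hg.fac (Fan.mk s.pt (legs s)) ⟨o⟩
  have fac_none (s : Cone K) :
      hg.lift (Fan.mk s.pt (legs s)) ≫ t.π.app none = s.π.app none := by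
    rw [← cancel_mono b, Category.assoc, ← hnone, fac]
  { lift s := hg.lift (Fan.mk s.pt (legs s))
    fac s := by
      rintro (_ | j)
      · exact fac_none s
      · refine BinaryFan.IsLimit.hom_ext (h j) ?_ ?_
        · change (_ ≫ _) ≫ K.map _ = _ ≫ K.map _
          rw [Category.assoc, t.w, s.w]
          exact fac_none s
        · change (_ ≫ _) ≫ r j = _ ≫ r j
          rw [Category.assoc, ← hsome, fac]
    uniq s m hm := by
      refine Fan.IsLimit.hom_ext hg _ _ ?_
      rintro (_ | j)
      · change m ≫ g none = _ ≫ g none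
        rw [fac, hnone, ← Category.assoc, hm]
      · change m ≫ g (some j) = _ ≫ g (some j)
        rw [fac, hsome, ← Category.assoc, hm] }

/-- Functors preserving finite products preserve the pullbacks of copies of a product
projection. -/
theorem preservesLimit_copies {D : Type*} [Category* D] [HasFiniteProducts C] {E X B : C}
    {q : E ⟶ X} {r : E ⟶ B} (h : IsLimit (BinaryFan.mk q r)) (n : ℕ) (F : C ⥤ D)
    [PreservesFiniteProducts F] : PreservesLimit (copies q n) F := by
  -- The pullback of `n` copies is `X × Bⁿ`: `none` indexes the base and `some i` the complement in
  -- the `i`-th copy. For `n = 0` this is `X`.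
  let Y : Option (Fin n) → C := fun o => o.elim X (fun _ => B)
  let t : Cone (copies q n) := WidePullbackShape.mkCone (X := ∏ᶜ Y) (Pi.π Y none)
    (fun i => h.lift (BinaryFan.mk (Pi.π Y none) (Pi.π Y (some i))))
    (fun i => h.fac (BinaryFan.mk (Pi.π Y none) (Pi.π Y (some i))) ⟨WalkingPair.left⟩)
  have hfst (i : Fin n) : t.π.app (some i) ≫ r = Pi.π Y (some i) :=
    h.fac (BinaryFan.mk (Pi.π Y none) (Pi.π Y (some i))) ⟨WalkingPair.right⟩
  have ht : IsLimit t := isLimitOfProductLegs (Y := Y) (𝟙 X) (inferInstanceAs (Mono (𝟙 X)))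
    (fun _ => r) (fun _ => h) t
    (fun o => Pi.π Y o) (productIsProduct Y) (Category.comp_id _).symm (fun j => (hfst j).symm)
  refine preservesLimit_of_preserves_limit_cone ht ?_
  refine isLimitOfProductLegs (Y := fun o => F.obj (Y o)) (𝟙 (F.obj X))
    (inferInstanceAs (Mono (𝟙 (F.obj X)))) (fun _ => F.map r)
    (fun _ => mapIsLimitOfPreservesOfIsLimit F q r h) (F.mapCone t) (fun o => F.map (Pi.π Y o))
    (isLimitFanMkObjOfIsLimit F Y (Pi.π Y) (productIsProduct Y)) (Category.comp_id _).symm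
    (fun j => ?_)
  exact (congrArg F.map (hfst j)).symm.trans (F.map_comp _ _)

/-- A commutative square between product projections with a common complementary factor is a
pullback. -/
theorem isPullback_of_isLimit_binaryFan {P Q X Y N : C} {top : P ⟶ Q} {a : P ⟶ X} {b : Q ⟶ Y}
    {f : X ⟶ Y} {r : Q ⟶ N} (w : top ≫ b = a ≫ f) (hb : IsLimit (BinaryFan.mk b r))
    (ha : IsLimit (BinaryFan.mk a (top ≫ r))) : IsPullback top a b f where
  w := w
  isLimit' := ⟨by
    have fac (s : PullbackCone b f) :=
      ha.fac (BinaryFan.mk s.snd (s.fst ≫ r))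
    refine PullbackCone.IsLimit.mk w (fun s => ha.lift (BinaryFan.mk s.snd (s.fst ≫ r)))
      (fun s => ?_) (fun s => fac s ⟨WalkingPair.left⟩) (fun s m h₁ h₂ => ?_)
    · refine BinaryFan.IsLimit.hom_ext hb ?_ ?_
      · change (_ ≫ top) ≫ b = s.fst ≫ b
        rw [Category.assoc, w, s.condition, ← Category.assoc]
        exact congrArg (· ≫ f) (fac s ⟨WalkingPair.left⟩)
      · change (_ ≫ top) ≫ r = s.fst ≫ r
        rw [Category.assoc]
        exact fac s ⟨WalkingPair.right⟩
    · refine BinaryFan.IsLimit.hom_ext ha ?_ ?_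
      · exact h₂.trans (fac s ⟨WalkingPair.left⟩).symm
      · refine Eq.trans ?_ (fac s ⟨WalkingPair.right⟩).symm
        change m ≫ top ≫ r = s.fst ≫ r
        rw [← h₁, Category.assoc]⟩

theorem map_isPullback_of_isLimit_binaryFan {D : Type*} [Category* D] {P Q X Y N : C}
    {top : P ⟶ Q} {a : P ⟶ X} {b : Q ⟶ Y} {f : X ⟶ Y} {r : Q ⟶ N} (w : top ≫ b = a ≫ f)
    (hb : IsLimit (BinaryFan.mk b r)) (ha : IsLimit (BinaryFan.mk a (top ≫ r))) (F : C ⥤ D)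
    [PreservesFiniteProducts F] :
    IsPullback (F.map top) (F.map a) (F.map b) (F.map f) :=
  isPullback_of_isLimit_binaryFan (by rw [← F.map_comp, w, F.map_comp])
    (mapIsLimitOfPreservesOfIsLimit F b r hb)
    (by
      rw [← F.map_comp]
      exact mapIsLimitOfPreservesOfIsLimit F a _ ha)

instance iter_preservesFiniteProducts (F : C ⥤ C) [PreservesFiniteProducts F] :
    ∀ m : ℕ, PreservesFiniteProducts (iter F m)
  | 0 => inferInstanceAs (PreservesFiniteProducts (𝟭 C))
  | m + 1 =>
    have := iter_preservesFiniteProducts F m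
    inferInstanceAs (PreservesFiniteProducts (iter F m ⋙ F))

end ProductProjections

/-! ### Product bundles -/

section Auxiliary

variable {C : Type u} [Category.{v} C] [CartesianMonoidalCategory C]

section

variable {D : Type*} [Category* D] (F : C ⥤ D)

@[simp]
theorem map_lift_fst {W X Y : C} (f : W ⟶ X) (g : W ⟶ Y) :
    F.map (lift f g) ≫ F.map (fst X Y) = F.map f := by
  rw [← F.map_comp, lift_fst]

@[simp]
theorem map_lift_snd {W X Y : C} (f : W ⟶ X) (g : W ⟶ Y) :
    F.map (lift f g) ≫ F.map (snd X Y) = F.map g := by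
  rw [← F.map_comp, lift_snd]

@[simp]
theorem map_tensorHom_fst {X Y X' Y' : C} (f : X ⟶ X') (g : Y ⟶ Y') :
    F.map (f ⊗ₘ g) ≫ F.map (fst X' Y') = F.map (fst X Y) ≫ F.map f := by
  rw [← F.map_comp, tensorHom_fst, F.map_comp]

@[simp]
theorem map_tensorHom_snd {X Y X' Y' : C} (f : X ⟶ X') (g : Y ⟶ Y') :
    F.map (f ⊗ₘ g) ≫ F.map (snd X' Y') = F.map (snd X Y) ≫ F.map g := by
  rw [← F.map_comp, tensorHom_snd, F.map_comp]

@[simp]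
theorem map_whiskerLeft_fst (X : C) {Y Z : C} (f : Y ⟶ Z) :
    F.map (X ◁ f) ≫ F.map (fst X Z) = F.map (fst X Y) := by
  rw [← F.map_comp, whiskerLeft_fst]

@[simp]
theorem map_whiskerLeft_snd (X : C) {Y Z : C} (f : Y ⟶ Z) :
    F.map (X ◁ f) ≫ F.map (snd X Z) = F.map (snd X Y) ≫ F.map f := by
  rw [← F.map_comp, whiskerLeft_snd, F.map_comp]

end

theorem lift_mul_comp {W M N : C} [MonObj M] [MonObj N] (a b : W ⟶ M) (f : M ⟶ N) [IsMonHom f] :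
    lift a b ≫ μ ≫ f = lift (a ≫ f) (b ≫ f) ≫ μ := by
  rw [IsMonHom.mul_hom, lift_map_assoc]

theorem comp_tensorHom_comp {W X Y X' Y' Z : C} (p : W ⟶ X ⊗ Y) (f : X ⟶ X') (g : Y ⟶ Y')
    (k : X' ⊗ Y' ⟶ Z) :
    p ≫ (f ⊗ₘ g) ≫ k = lift (p ≫ fst X Y ≫ f) (p ≫ snd X Y ≫ g) ≫ k := by
  rw [← lift_fst_comp_snd_comp, comp_lift_assoc]

variable [HasZeroMorphisms C]

/-- The product bundle `X × M ⟶ X` with the additive structure of a monoid `M`. -/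
abbrev productBundle (X M : C) [MonObj M] : AdditiveBundleData X where
  E := X ⊗ M
  q := fst X M
  E₂ := X ⊗ (M ⊗ M)
  ρ₁ := X ◁ fst M M
  ρ₂ := X ◁ snd M M
  add := X ◁ μ
  zero := lift (𝟙 X) 0

theorem productBundle_isPullback (X M : C) [MonObj M] :
    IsPullback (X ◁ fst M M) (X ◁ snd M M) (fst X M) (fst X M) where
  w := by simp
  isLimit' := ⟨PullbackCone.IsLimit.mk _
    (fun s => lift (s.fst ≫ fst _ _) (lift (s.fst ≫ snd _ _) (s.snd ≫ snd _ _)))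
    (fun s => by ext <;> simp) (fun s => by ext <;> simp [s.condition])
    (fun s m h₁ h₂ => by ext <;> simp [← h₁, ← h₂])⟩

/-- In fibre coordinates the sum is `(x, a + b)`, which reduces the additive bundle axioms to the
monoid laws of `M`. -/
theorem productBundle_lift {X M W : C} [MonObj M] (a b : W ⟶ X ⊗ M)
    (h : a ≫ fst X M = b ≫ fst X M) :
    (productBundle_isPullback X M).lift a b h ≫ X ◁ μ =
      lift (a ≫ fst X M) (lift (a ≫ snd X M) (b ≫ snd X M) ≫ μ) := by
  have : (productBundle_isPullback X M).lift a b h =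
      lift (a ≫ fst X M) (lift (a ≫ snd X M) (b ≫ snd X M)) := by
    apply (productBundle_isPullback X M).hom_ext
    · rw [IsPullback.lift_fst]
      ext <;> simp
    · rw [IsPullback.lift_snd]
      ext <;> simp [h]
  rw [this]
  ext <;> simp

theorem productBundle_isAdditiveBundle [BraidedCategory C] [HasFiniteLimits C] (X M : C)
    [MonObj M] [IsCommMonObj M] : (productBundle X M).IsAdditiveBundle where
  hasPowers n := inferInstanceAs (HasLimit (copies (fst X M) n))
  isPullback := productBundle_isPullback X M
  add_proj := by dsimp only; simp
  zero_proj := by dsimp only; simp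
  add_assoc {W} a b c hab hbc := by
    change W ⟶ X ⊗ M at a b c
    dsimp only at hab hbc
    simp only [productBundle_lift, lift_fst, lift_snd]
    rw [MonObj.lift_lift_assoc]
  zero_add {W} a := by
    change W ⟶ X ⊗ M at a
    simp only [productBundle_lift]
    ext <;> simp [lift_zero_left_comp_mul]
  add_zero {W} a := by
    change W ⟶ X ⊗ M at a
    simp only [productBundle_lift]
    ext <;> simp [lift_zero_right_comp_mul]
  add_comm {W} a b hab := by
    change W ⟶ X ⊗ M at a b
    dsimp only at hab
    simp only [productBundle_lift, hab]
    congr 1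
    conv_lhs => rw [← IsCommMonObj.mul_comm M]
    rw [← Category.assoc, lift_braiding_hom]

end Auxiliary

namespace LinearAssignment

/-! ### The algebra of a linear assignment -/

variable {C : Type u} [Category.{v} C] [CartesianMonoidalCategory C] [BraidedCategory C]
  [HasZeroMorphisms C] (𝓛 : LinearAssignment C)

@[simp]
theorem zero_eq_zero (Y X : C) : 𝓛.zero Y X = 0 := by
  rw [zero, one_eq_zero, Limits.comp_zero]

@[simp]
theorem map_zero (X Y : C) : 𝓛.L.map (0 : X ⟶ Y) = 0 := by
  have h : 𝓛.L.map (toUnit X) = 0 := by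
    rw [← cancel_mono (CartesianMonoidalCategory.terminalComparison 𝓛.L)]
    exact toUnit_unique _ _
  have h' : (0 : X ⟶ Y) = toUnit X ≫ 0 := Limits.comp_zero.symm
  rw [h', 𝓛.L.map_comp, h, Limits.zero_comp]

theorem hom_ext {W X Y : C} {f g : W ⟶ 𝓛.L.obj (X ⊗ Y)}
    (h₁ : f ≫ 𝓛.L.map (fst X Y) = g ≫ 𝓛.L.map (fst X Y))
    (h₂ : f ≫ 𝓛.L.map (snd X Y) = g ≫ 𝓛.L.map (snd X Y)) : f = g := by
  rw [← cancel_mono (𝓛.ω X Y)]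
  ext <;> simpa

/-- The morphism to `L (X × Y)` with given components. -/
def pairing {W X Y : C} (f : W ⟶ 𝓛.L.obj X) (g : W ⟶ 𝓛.L.obj Y) : W ⟶ 𝓛.L.obj (X ⊗ Y) :=
  lift f g ≫ inv (𝓛.ω X Y)

@[simp]
theorem pairing_map_fst {W X Y : C} (f : W ⟶ 𝓛.L.obj X) (g : W ⟶ 𝓛.L.obj Y) :
    𝓛.pairing f g ≫ 𝓛.L.map (fst X Y) = f := by
  simp [pairing]

@[simp]
theorem pairing_map_snd {W X Y : C} (f : W ⟶ 𝓛.L.obj X) (g : W ⟶ 𝓛.L.obj Y) :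
    𝓛.pairing f g ≫ 𝓛.L.map (snd X Y) = g := by
  simp [pairing]

/-- The functor `L` sends the sum of a monoid `M` to the sum of `L M`. -/
theorem comp_map_mul {W M : C} [MonObj M] (p : W ⟶ 𝓛.L.obj (M ⊗ M)) :
    p ≫ 𝓛.L.map μ = lift (p ≫ 𝓛.L.map (fst M M)) (p ≫ 𝓛.L.map (snd M M)) ≫ μ := by
  -- Every `p` is `L(ι₁)p₁ + L(ι₂)p₂`; the monoid morphism `L μ` then acts as the identity on each
  -- summand, as `μ` restricts to the identity on each axis.
  have hp : p = lift (p ≫ 𝓛.L.map (fst M M) ≫ 𝓛.L.map (quasiInl M M))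
      (p ≫ 𝓛.L.map (snd M M) ≫ 𝓛.L.map (quasiInr M M)) ≫ μ := by
    apply 𝓛.hom_ext
    · simp [quasiInl, quasiInr, lift_zero_right_comp_mul]
    · simp [quasiInl, quasiInr, lift_zero_left_comp_mul]
  conv_lhs => rw [hp]
  rw [Category.assoc, lift_mul_comp]
  simp only [Category.assoc, ← 𝓛.L.map_comp, quasiInl_mul, quasiInr_mul, Category.comp_id]

/-- In coordinates this is `1 × ω` followed by the middle interchange, both invertible. -/
theorem isIso_tangent_prodComparison (X Y : C) :
    IsIso (CartesianMonoidalCategory.prodComparison 𝓛.tangent X Y) := by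
  have : IsIso (tensorμ X Y (𝓛.L.obj X) (𝓛.L.obj Y)) :=
    ⟨tensorδ .., tensorμ_tensorδ .., tensorδ_tensorμ ..⟩
  have h : lift (fst X Y ⊗ₘ 𝓛.L.map (fst X Y)) (snd X Y ⊗ₘ 𝓛.L.map (snd X Y)) =
      (X ⊗ Y) ◁ 𝓛.ω X Y ≫ tensorμ X Y (𝓛.L.obj X) (𝓛.L.obj Y) := by
    ext <;> simp
  have : IsIso (lift (fst X Y ⊗ₘ 𝓛.L.map (fst X Y)) (snd X Y ⊗ₘ 𝓛.L.map (snd X Y))) := by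
    rw [h]
    infer_instance
  exact this

instance tangent_preservesFiniteProducts [HasFiniteProducts C] :
    PreservesFiniteProducts 𝓛.tangent := by
  have := isIso_tangent_prodComparison 𝓛
  have : IsIso (CartesianMonoidalCategory.terminalComparison 𝓛.tangent) := by
    refine ⟨0, ?_, toUnit_unique _ _⟩
    change _ = 𝟙 (𝟙_ C ⊗ 𝓛.L.obj (𝟙_ C))
    apply CartesianMonoidalCategory.hom_ext
    · exact toUnit_unique _ _
    · rw [← cancel_mono (CartesianMonoidalCategory.terminalComparison 𝓛.L)]
      exact toUnit_unique _ _
  have := preservesLimit_empty_of_isIso_terminalComparison 𝓛.tangent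
  have := preservesLimitsOfShape_pempty_of_preservesTerminal 𝓛.tangent
  have := preservesLimitsOfShape_discrete_walkingPair_of_isIso_prodComparison 𝓛.tangent
  exact PreservesFiniteProducts.of_preserves_binary_and_terminal 𝓛.tangent

end LinearAssignment

/-! ### The lift of a product bundle and the canonical flip -/

@[simp]
theorem map_lift_fst_assoc {C D : Type*} [Category* C] [CartesianMonoidalCategory C] [Category* D]
    (F : C ⥤ D) {W X Y : C} (f : W ⟶ X) (g : W ⟶ Y) {Z : D} (k : F.obj X ⟶ Z) :
    F.map (lift f g) ≫ F.map (fst X Y) ≫ k = F.map f ≫ k := by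
  rw [← Category.assoc, map_lift_fst]

@[simp]
theorem map_lift_snd_assoc {C D : Type*} [Category* C] [CartesianMonoidalCategory C] [Category* D]
    (F : C ⥤ D) {W X Y : C} (f : W ⟶ X) (g : W ⟶ Y) {Z : D} (k : F.obj Y ⟶ Z) :
    F.map (lift f g) ≫ F.map (snd X Y) ≫ k = F.map g ≫ k := by
  rw [← Category.assoc, map_lift_snd]

namespace LinearAssignment

variable {C : Type u} [Category.{v} C] [CartesianMonoidalCategory C] [BraidedCategory C]
  [HasZeroMorphisms C] (𝓛 : LinearAssignment C)

theorem hom_ext₂ {W X Y : C} {f g : W ⟶ 𝓛.L.obj (𝓛.L.obj (X ⊗ Y))}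
    (h₁ : f ≫ 𝓛.L.map (𝓛.L.map (fst X Y)) = g ≫ 𝓛.L.map (𝓛.L.map (fst X Y)))
    (h₂ : f ≫ 𝓛.L.map (𝓛.L.map (snd X Y)) = g ≫ 𝓛.L.map (𝓛.L.map (snd X Y))) : f = g := by
  rw [← cancel_mono (𝓛.L.map (𝓛.ω X Y))]
  apply 𝓛.hom_ext
  · simpa [← 𝓛.L.map_comp] using h₁
  · simpa [← 𝓛.L.map_comp] using h₂

@[simp]
theorem comp_pairing {V W X Y : C} (h : V ⟶ W) (f : W ⟶ 𝓛.L.obj X) (g : W ⟶ 𝓛.L.obj Y) :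
    h ≫ 𝓛.pairing f g = 𝓛.pairing (h ≫ f) (h ≫ g) := by
  apply 𝓛.hom_ext <;> simp

@[simp]
theorem pairing_map_fst_assoc {W X Y Z : C} (f : W ⟶ 𝓛.L.obj X) (g : W ⟶ 𝓛.L.obj Y)
    (k : 𝓛.L.obj X ⟶ Z) : 𝓛.pairing f g ≫ 𝓛.L.map (fst X Y) ≫ k = f ≫ k := by
  rw [← Category.assoc, pairing_map_fst]

@[simp]
theorem pairing_map_snd_assoc {W X Y Z : C} (f : W ⟶ 𝓛.L.obj X) (g : W ⟶ 𝓛.L.obj Y)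
    (k : 𝓛.L.obj Y ⟶ Z) : 𝓛.pairing f g ≫ 𝓛.L.map (snd X Y) ≫ k = g ≫ k := by
  rw [← Category.assoc, pairing_map_snd]

@[simp]
theorem map_pairing_map_fst {W X Y : C} (f : W ⟶ 𝓛.L.obj X) (g : W ⟶ 𝓛.L.obj Y) :
    𝓛.L.map (𝓛.pairing f g) ≫ 𝓛.L.map (𝓛.L.map (fst X Y)) = 𝓛.L.map f := by
  rw [← 𝓛.L.map_comp, pairing_map_fst]

@[simp]
theorem map_pairing_map_snd {W X Y : C} (f : W ⟶ 𝓛.L.obj X) (g : W ⟶ 𝓛.L.obj Y) :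
    𝓛.L.map (𝓛.pairing f g) ≫ 𝓛.L.map (𝓛.L.map (snd X Y)) = 𝓛.L.map g := by
  rw [← 𝓛.L.map_comp, pairing_map_snd]

/-- The lift `(x, m) ↦ (x, 0, 0, e m)` of the product bundle `X × M ⟶ X`. -/
def productLift (X : C) {M : C} (e : M ⟶ 𝓛.L.obj M) :
    X ⊗ M ⟶ (X ⊗ M) ⊗ 𝓛.L.obj (X ⊗ M) :=
  lift (lift (fst X M) 0) (𝓛.pairing 0 (snd X M ≫ e))

/-- The vertical lift is the case `M = LX`, `e = ν⁻¹` of the product lift, so one computation serves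
both the tangent structure and the product bundles. -/
theorem vlift_eq (X : C) : 𝓛.vlift X = 𝓛.productLift X (𝓛.ν.inv.app X) := by
  apply CartesianMonoidalCategory.hom_ext
  · ext <;> simp [vlift, productLift]
  · apply 𝓛.hom_ext <;> simp [vlift, productLift]

/-- The coordinate form `(x, a; b, c) ↦ (x, b; a, c)`, in which the flip axioms are checked one
coordinate at a time. -/
theorem flip_eq (X : C) : 𝓛.flip X =
    lift (fst _ _ ⊗ₘ 𝓛.L.map (fst _ _)) (𝓛.pairing (fst _ _ ≫ snd _ _)
      (snd _ _ ≫ 𝓛.L.map (snd _ _))) := by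
  apply CartesianMonoidalCategory.hom_ext
  · ext <;> simp [flip]
  · apply 𝓛.hom_ext <;> simp [flip]

theorem flip_flip (X : C) : 𝓛.flip X ≫ 𝓛.flip X = 𝟙 _ := by
  rw [flip_eq]
  apply CartesianMonoidalCategory.hom_ext
  · ext <;> simp
  · apply 𝓛.hom_ext <;> simp

/-- The coordinates of `T³X` correspond to sets of tangent directions among three; both sides
permute them by reversing the order of the directions. -/
theorem flip_braid (X : C) :
    (𝓛.flip X ⊗ₘ 𝓛.L.map (𝓛.flip X)) ≫ 𝓛.flip (X ⊗ 𝓛.L.obj X) ≫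
        (𝓛.flip X ⊗ₘ 𝓛.L.map (𝓛.flip X)) =
      𝓛.flip (X ⊗ 𝓛.L.obj X) ≫ (𝓛.flip X ⊗ₘ 𝓛.L.map (𝓛.flip X)) ≫
        𝓛.flip (X ⊗ 𝓛.L.obj X) := by
  simp only [flip_eq]
  apply CartesianMonoidalCategory.hom_ext
  · apply CartesianMonoidalCategory.hom_ext
    · ext <;> simp
    · apply 𝓛.hom_ext <;> simp
  · apply 𝓛.hom_ext
    · apply 𝓛.hom_ext <;> simp
    · apply 𝓛.hom_ext₂ <;> simp

theorem vlift_flip (X : C) : 𝓛.vlift X ≫ 𝓛.flip X = 𝓛.vlift X := by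
  rw [flip_eq, vlift_eq, productLift]
  apply CartesianMonoidalCategory.hom_ext
  · ext <;> simp
  · apply 𝓛.hom_ext <;> simp

theorem map_ν_inv (X : C) : 𝓛.L.map (𝓛.ν.inv.app X) = 𝓛.ν.inv.app (𝓛.L.obj X) := by
  rw [← cancel_mono (𝓛.ν.hom.app (𝓛.L.obj X)), Iso.inv_hom_id_app, 𝓛.ν_obj, ← 𝓛.L.map_comp,
    Iso.inv_hom_id_app]
  simp

theorem vlift_flip_flip (X : C) :
    𝓛.vlift (X ⊗ 𝓛.L.obj X) ≫ (𝓛.flip X ⊗ₘ 𝓛.L.map (𝓛.flip X)) ≫ 𝓛.flip (X ⊗ 𝓛.L.obj X) =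
      𝓛.flip X ≫ (𝓛.vlift X ⊗ₘ 𝓛.L.map (𝓛.vlift X)) := by
  simp only [flip_eq, vlift_eq, productLift]
  apply CartesianMonoidalCategory.hom_ext
  · apply CartesianMonoidalCategory.hom_ext
    · ext <;> simp
    · apply 𝓛.hom_ext <;> simp
  · apply 𝓛.hom_ext
    · apply 𝓛.hom_ext <;> simp
    · apply 𝓛.hom_ext₂ <;> simp [map_ν_inv, ν_inv_naturality, -NatTrans.naturality]

/-- Only the last coordinate is not formal: it compares `e` followed by `L e` with `e` followed by
`ν⁻¹`, whence `he`. -/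
theorem productLift_coassoc (X : C) {M : C} (e : M ⟶ 𝓛.L.obj M)
    (he : 𝓛.L.map e = 𝓛.ν.inv.app M) :
    𝓛.productLift X e ≫ (𝓛.productLift X e ⊗ₘ 𝓛.L.map (𝓛.productLift X e)) =
      𝓛.productLift X e ≫ 𝓛.vlift (X ⊗ M) := by
  simp only [vlift_eq, productLift]
  apply CartesianMonoidalCategory.hom_ext
  · apply CartesianMonoidalCategory.hom_ext
    · ext <;> simp
    · apply 𝓛.hom_ext <;> simp
  · apply 𝓛.hom_ext
    · apply 𝓛.hom_ext <;> simp
    · apply 𝓛.hom_ext₂ <;> simp [he, ν_inv_naturality, -NatTrans.naturality]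

end LinearAssignment

namespace LinearAssignment

/-! ### The tangent structure -/

variable {C : Type u} [Category.{v} C] [CartesianMonoidalCategory C] [BraidedCategory C]
  [HasZeroMorphisms C] (𝓛 : LinearAssignment C)

/-! ### Additivity and universality of the lift of a product bundle -/

section ProductLift

variable (X : C) {M : C} [MonObj M] (e : M ⟶ 𝓛.L.obj M)

theorem bundle_eq (X : C) : 𝓛.tangentData.bundle X = productBundle X (𝓛.L.obj X) := by
  simp only [TangentData.bundle, tangentData, zero_eq_zero]
  rfl

/-- The sum of the image bundle involves `L μ`, which by `comp_map_mul` is the sum of `LM`;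
additivity of `e` then suffices. -/
theorem productLift_additive_zero [IsMonHom e] :
    IsAdditiveBundleMorphism (productBundle X M) ((productBundle X M).map 𝓛.tangent)
      (𝓛.productLift X e) (lift (𝟙 X) 0) where
  proj := by
    change 𝓛.productLift X e ≫ (fst X M ⊗ₘ 𝓛.L.map (fst X M)) = fst X M ≫ lift (𝟙 X) 0
    ext <;> simp [productLift]
  add := by
    -- In coordinates, `(x, m₁, m₂) ↦ (x, 0, 0; 0, e m₁, e m₂)`.
    refine ⟨lift (lift (fst _ _) 0)
      (𝓛.pairing 0 (𝓛.pairing (snd _ _ ≫ fst _ _ ≫ e) (snd _ _ ≫ snd _ _ ≫ e))), ?_, ?_, ?_⟩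
    · change _ ≫ (X ◁ fst M M ⊗ₘ 𝓛.L.map (X ◁ fst M M)) = X ◁ fst M M ≫ 𝓛.productLift X e
      apply CartesianMonoidalCategory.hom_ext
      · ext <;> simp [productLift]
      · apply 𝓛.hom_ext <;> simp [productLift]
    · change _ ≫ (X ◁ snd M M ⊗ₘ 𝓛.L.map (X ◁ snd M M)) = X ◁ snd M M ≫ 𝓛.productLift X e
      apply CartesianMonoidalCategory.hom_ext
      · ext <;> simp [productLift]
      · apply 𝓛.hom_ext <;> simp [productLift]
    · change X ◁ μ ≫ 𝓛.productLift X e = _ ≫ (X ◁ μ ⊗ₘ 𝓛.L.map (X ◁ μ))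
      apply CartesianMonoidalCategory.hom_ext
      · ext <;> simp [productLift]
      · apply 𝓛.hom_ext <;> 
          simp [productLift, comp_map_mul, comp_tensorHom_comp, comp_lift_assoc]
  zero := by
    change lift (𝟙 X) 0 ≫ 𝓛.productLift X e =
      lift (𝟙 X) 0 ≫ (lift (𝟙 X) 0 ⊗ₘ 𝓛.L.map (lift (𝟙 X) 0))
    apply CartesianMonoidalCategory.hom_ext
    · ext <;> simp [productLift]
    · apply 𝓛.hom_ext <;> simp [productLift]

theorem productLift_additive [IsMonHom e] :
    IsAdditiveBundleMorphism (productBundle X M) (𝓛.tangentData.bundle (X ⊗ M))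
      (𝓛.productLift X e) (lift (𝟙 X) 0) :=
  { proj := by
      change 𝓛.productLift X e ≫ fst _ _ = fst X M ≫ lift (𝟙 X) 0
      ext <;> simp [productLift]
    add := by
      refine ⟨lift (lift (fst _ _) 0) (lift (𝓛.pairing 0 (snd _ _ ≫ fst _ _ ≫ e))
        (𝓛.pairing 0 (snd _ _ ≫ snd _ _ ≫ e))), ?_, ?_, ?_⟩
      · change _ ≫ (X ⊗ M) ◁ fst _ _ = X ◁ fst M M ≫ 𝓛.productLift X e
        ext <;> simp [productLift]
      · change _ ≫ (X ⊗ M) ◁ snd _ _ = X ◁ snd M M ≫ 𝓛.productLift X e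
        ext <;> simp [productLift]
      · change X ◁ μ ≫ 𝓛.productLift X e = _ ≫ (X ⊗ M) ◁ μ
        apply CartesianMonoidalCategory.hom_ext
        · ext <;> simp [productLift]
        · apply 𝓛.hom_ext <;>
            simp [productLift, comp_tensorHom_comp, lift_zero_right_comp_mul]
    zero := by
      change lift (𝟙 X) 0 ≫ 𝓛.productLift X e = lift (𝟙 X) 0 ≫ lift (𝟙 (X ⊗ M)) (𝓛.zero _ _)
      apply CartesianMonoidalCategory.hom_ext
      · ext <;> simp [productLift]
      · apply 𝓛.hom_ext <;> simp [productLift] }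

/-- The product decomposition used to show that the lift of a product bundle is universal. -/
def isLimitFstSwap [IsIso e] : IsLimit (BinaryFan.mk (fst X (M ⊗ M))
    (lift (snd X (M ⊗ M) ≫ snd M M) (snd X (M ⊗ M) ≫ fst M M ≫ e))) :=
  BinaryFan.IsLimit.mk _
    (fun f g => lift f (lift (g ≫ snd _ _ ≫ inv e) (g ≫ fst _ _)))
    (fun f g => by simp) (fun f g => by dsimp; ext <;> simp)
    (fun {T} f g (m : T ⟶ X ⊗ (M ⊗ M)) h₁ h₂ => by
      dsimp at h₁ h₂
      subst h₁ h₂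
      refine CartesianMonoidalCategory.hom_ext (X := X) (Y := M ⊗ M) m _ ?_
        (CartesianMonoidalCategory.hom_ext _ _ ?_ ?_) <;> simp)

/-- The top side is `(x, m₁, m₂) ↦ (x, m₂; 0, e m₁)`. Under `T(X × M) ≅ TX × TM` its part in `TM` is
`(m₂, e m₁)`, and `(m₁, m₂) ↦ (m₂, e m₁)` is invertible with `e`. So both vertical sides are product
projections with complement `TM`, a situation preserved by all powers of `T`. -/
theorem productLift_universal [HasFiniteProducts C] [IsIso e] :
    ∃ w : X ⊗ (M ⊗ M) ⟶ 𝓛.tangent.obj (X ⊗ (M ⊗ M)),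
      w ≫ 𝓛.tangent.map (X ◁ fst M M) = X ◁ fst M M ≫ 𝓛.productLift X e ∧
      w ≫ 𝓛.tangent.map (X ◁ snd M M) =
        X ◁ snd M M ≫ lift (𝟙 (X ⊗ M)) (𝓛.zero (X ⊗ M) (X ⊗ M)) ∧
      ∀ m : ℕ, IsPullback ((iter 𝓛.tangent m).map (w ≫ 𝓛.tangent.map (X ◁ μ)))
        ((iter 𝓛.tangent m).map (X ◁ fst M M ≫ fst X M))
        ((iter 𝓛.tangent m).map (𝓛.tangent.map (fst X M)))
        ((iter 𝓛.tangent m).map (lift (𝟙 X) (𝓛.zero X X))) := by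
  let w : X ⊗ (M ⊗ M) ⟶ (X ⊗ (M ⊗ M)) ⊗ 𝓛.L.obj (X ⊗ (M ⊗ M)) :=
    lift (lift (fst _ _) (lift 0 (snd _ _ ≫ snd _ _)))
      (𝓛.pairing 0 (𝓛.pairing (snd _ _ ≫ fst _ _ ≫ e) 0))
  let top : X ⊗ (M ⊗ M) ⟶ (X ⊗ M) ⊗ 𝓛.L.obj (X ⊗ M) :=
    lift (lift (fst _ _) (snd _ _ ≫ snd _ _)) (𝓛.pairing 0 (snd _ _ ≫ fst _ _ ≫ e))
  have htop : w ≫ (X ◁ μ ⊗ₘ 𝓛.L.map (X ◁ μ)) = top := by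
    apply CartesianMonoidalCategory.hom_ext
    · ext <;> simp [w, top, lift_zero_left_comp_mul]
    · apply 𝓛.hom_ext <;> simp [w, top, comp_map_mul, comp_lift_assoc, lift_zero_right_comp_mul]
  have htop' : top ≫ 𝓛.tangent.map (snd X M) =
      lift (snd X (M ⊗ M) ≫ snd M M) (snd X (M ⊗ M) ≫ fst M M ≫ e) := by
    change top ≫ (snd X M ⊗ₘ 𝓛.L.map (snd X M)) = _
    ext <;> simp [top]
  refine ⟨w, ?_, ?_, fun m => ?_⟩
  · change w ≫ (X ◁ fst M M ⊗ₘ 𝓛.L.map (X ◁ fst M M)) = _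
    apply CartesianMonoidalCategory.hom_ext
    · ext <;> simp [w, productLift]
    · apply 𝓛.hom_ext <;> simp [w, productLift]
  · change w ≫ (X ◁ snd M M ⊗ₘ 𝓛.L.map (X ◁ snd M M)) = _
    apply CartesianMonoidalCategory.hom_ext
    · ext <;> simp [w]
    · apply 𝓛.hom_ext <;> simp [w]
  · suffices h : ∀ t : X ⊗ (M ⊗ M) ⟶ 𝓛.tangent.obj (X ⊗ M), t = top →
        IsPullback ((iter 𝓛.tangent m).map t) ((iter 𝓛.tangent m).map (X ◁ fst M M ≫ fst X M))
          ((iter 𝓛.tangent m).map (𝓛.tangent.map (fst X M)))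
          ((iter 𝓛.tangent m).map (lift (𝟙 X) (𝓛.zero X X))) from h _ htop
    rintro _ rfl
    rw [whiskerLeft_fst]
    refine map_isPullback_of_isLimit_binaryFan ?_ (mapIsLimitOfPreservesOfIsLimit 𝓛.tangent _ _
      (tensorProductIsBinaryProduct X M)) ?_ _
    · change top ≫ (fst X M ⊗ₘ 𝓛.L.map (fst X M)) = fst X (M ⊗ M) ≫ lift (𝟙 X) (𝓛.zero X X)
      ext <;> simp [top]
    · suffices h : ∀ t, t = lift (snd X (M ⊗ M) ≫ snd M M) (snd X (M ⊗ M) ≫ fst M M ≫ e) →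
        IsLimit (BinaryFan.mk (fst X (M ⊗ M)) t) from h _ htop'
      rintro _ rfl
      exact 𝓛.isLimitFstSwap X e

end ProductLift

theorem flip_additive (X : C) :
    IsAdditiveBundleMorphism ((𝓛.tangentData.bundle X).map 𝓛.tangent)
      (𝓛.tangentData.bundle (X ⊗ 𝓛.L.obj X)) (𝓛.flip X) (𝟙 (X ⊗ 𝓛.L.obj X)) := by
  have h := 𝓛.flip_eq X
  generalize 𝓛.flip X = c at h ⊢
  subst h
  exact
  { proj := by
      change _ ≫ fst _ _ = (fst _ _ ⊗ₘ 𝓛.L.map (fst _ _)) ≫ 𝟙 _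
      ext <;> simp
    add := by
      -- In coordinates, `(x, a₁, a₂; b, c₁, c₂) ↦ (x, b; (a₁, c₁), (a₂, c₂))`.
      let f₂ : (X ⊗ (𝓛.L.obj X ⊗ 𝓛.L.obj X)) ⊗ 𝓛.L.obj (X ⊗ (𝓛.L.obj X ⊗ 𝓛.L.obj X)) ⟶
          (X ⊗ 𝓛.L.obj X) ⊗ (𝓛.L.obj (X ⊗ 𝓛.L.obj X) ⊗ 𝓛.L.obj (X ⊗ 𝓛.L.obj X)) :=
        lift (fst _ _ ⊗ₘ 𝓛.L.map (fst _ _))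
          (lift
            (𝓛.pairing (fst _ _ ≫ snd _ _ ≫ fst _ _)
              (snd _ _ ≫ 𝓛.L.map (snd _ _) ≫ 𝓛.L.map (fst _ _)))
            (𝓛.pairing (fst _ _ ≫ snd _ _ ≫ snd _ _)
              (snd _ _ ≫ 𝓛.L.map (snd _ _) ≫ 𝓛.L.map (snd _ _))))
      refine ⟨f₂, ?_, ?_, ?_⟩
      · change f₂ ≫ (X ⊗ 𝓛.L.obj X) ◁ fst _ _ = (X ◁ fst _ _ ⊗ₘ 𝓛.L.map (X ◁ fst _ _)) ≫ _
        apply CartesianMonoidalCategory.hom_ext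
        · ext <;> simp [f₂]
        · apply 𝓛.hom_ext <;> simp [f₂]
      · change f₂ ≫ (X ⊗ 𝓛.L.obj X) ◁ snd _ _ = (X ◁ snd _ _ ⊗ₘ 𝓛.L.map (X ◁ snd _ _)) ≫ _
        apply CartesianMonoidalCategory.hom_ext
        · ext <;> simp [f₂]
        · apply 𝓛.hom_ext <;> simp [f₂]
      · change (X ◁ μ ⊗ₘ 𝓛.L.map (X ◁ μ)) ≫ _ = f₂ ≫ (X ⊗ 𝓛.L.obj X) ◁ μ
        apply CartesianMonoidalCategory.hom_ext
        · ext <;> simp [f₂]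
        · apply 𝓛.hom_ext
          · simp [f₂]
            rw [← comp_lift_assoc, ← comp_lift_assoc, lift_fst_snd, Category.id_comp]
          · simp [f₂, comp_map_mul, comp_lift_assoc]
    zero := by
      change (lift (𝟙 X) (𝓛.zero _ _) ⊗ₘ 𝓛.L.map (lift (𝟙 X) (𝓛.zero _ _))) ≫ _ =
        𝟙 _ ≫ lift (𝟙 (X ⊗ 𝓛.L.obj X)) (𝓛.zero _ _)
      apply CartesianMonoidalCategory.hom_ext
      · ext <;> simp
      · apply 𝓛.hom_ext <;> simp }

instance isMonHom_ν_inv (X : C) : IsMonHom (M := 𝓛.L.obj X) (N := 𝓛.L.obj (𝓛.L.obj X))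
    (𝓛.ν.inv.app X) :=
  let i : 𝓛.L.obj (𝓛.L.obj X) ≅ 𝓛.L.obj X := 𝓛.ν.app X
  have : IsMonHom i.hom := 𝓛.isMonHom_ν X
  inferInstanceAs (IsMonHom i.inv)

/-- The tangent structure of a linear assignment on a category with zero morphisms. -/
def tangentStructure [HasFiniteLimits C] : TangentStructure C where
  toTangentData := 𝓛.tangentData
  isAdditiveBundle X := by
    rw [bundle_eq]
    exact productBundle_isAdditiveBundle X (𝓛.L.obj X)
  preservesPowers X m n :=
    have : PreservesFiniteProducts (iter 𝓛.tangentData.T m) :=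
      iter_preservesFiniteProducts 𝓛.tangent m
    preservesLimit_copies (tensorProductIsBinaryProduct X (𝓛.L.obj X)) n _
  lift_additive X := by
    have h := 𝓛.productLift_additive_zero X
      (M := 𝓛.L.obj X) (𝓛.ν.inv.app X)
    rw [← vlift_eq] at h
    exact
    { proj := by
        have h' := h.proj
        rw [← 𝓛.zero_eq_zero X X] at h'
        exact h'
      add := h.add
      zero := by
        change lift (𝟙 X) (𝓛.zero X X) ≫ 𝓛.vlift X =
          lift (𝟙 X) (𝓛.zero X X) ≫ 𝓛.tangent.map (lift (𝟙 X) (𝓛.zero X X))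
        rw [zero_eq_zero]
        exact h.zero }
  lift_coassoc X := by
    have h := 𝓛.productLift_coassoc X (M := 𝓛.L.obj X) (𝓛.ν.inv.app X) (𝓛.map_ν_inv X)
    rw [← vlift_eq] at h
    exact h.symm
  lift_universal X := by
    obtain ⟨w, h₁, h₂, h₃⟩ := 𝓛.productLift_universal X (M := 𝓛.L.obj X) (𝓛.ν.inv.app X)
    rw [← vlift_eq] at h₁
    exact ⟨w, h₁, h₂, h₃ 0⟩
  flip_flip := 𝓛.flip_flip
  flip_braid := 𝓛.flip_braid
  flip_additive := 𝓛.flip_additive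
  lift_flip := 𝓛.vlift_flip
  lift_flip_flip := 𝓛.vlift_flip_flip

theorem tangentStructure_isCartesian [HasFiniteLimits C] : 𝓛.tangentStructure.IsCartesian :=
  𝓛.tangent_preservesFiniteProducts

/-- The product bundle of an object and a commutative monoid `M` with `M ≅ L M`, as a differential
bundle. -/
def productDifferentialBundle [HasFiniteLimits C] (X M : C) [MonObj M] [IsCommMonObj M]
    (e : M ⟶ 𝓛.L.obj M) [IsMonHom e] [IsIso e] (he : 𝓛.L.map e = 𝓛.ν.inv.app M) :
    DifferentialBundleOver 𝓛.tangentStructure X where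
  toAdditiveBundleData := productBundle X M
  lam := 𝓛.productLift X e
  isAdditiveBundle := productBundle_isAdditiveBundle X M
  preservesPowers m n :=
    have : PreservesFiniteProducts (iter 𝓛.tangentStructure.T m) :=
      iter_preservesFiniteProducts 𝓛.tangent m
    preservesLimit_copies (tensorProductIsBinaryProduct X M) n _
  lift_additive_zero := by
    have h := 𝓛.productLift_additive_zero X e
    rw [← 𝓛.zero_eq_zero X X] at h
    exact h
  lift_additive := 𝓛.productLift_additive X e
  lift_coassoc := 𝓛.productLift_coassoc X e he
  lift_universal := 𝓛.productLift_universal X e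

end LinearAssignment

/-! ### Classification of differential bundles -/

/-- A functor preserving the pullback of two copies of `q` keeps its projections jointly monic. -/
theorem map_hom_ext_of_preservesLimit_copies {C : Type u} [Category.{v} C] {E X E₂ : C}
    {q : E ⟶ X} {ρ₁ ρ₂ : E₂ ⟶ E} (h : IsPullback ρ₁ ρ₂ q q) (F : C ⥤ C)
    [PreservesLimit (copies q 2) F] {W : C} {f g : W ⟶ F.obj E₂}
    (h₁ : f ≫ F.map ρ₁ = g ≫ F.map ρ₁) (h₂ : f ≫ F.map ρ₂ = g ≫ F.map ρ₂) : f = g := by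
  let t : Cone (copies q 2) := WidePullbackShape.mkCone (X := E₂) (ρ₁ ≫ q)
    (fun i => Fin.cases ρ₁ (fun _ => ρ₂) i) (fun i => by
      fin_cases i
      · rfl
      · exact h.w.symm)
  have w (s : Cone (copies q 2)) (i : Fin 2) : s.π.app (some i) ≫ q = s.π.app none :=
    s.w (WidePullbackShape.Hom.term i)
  let l (s : Cone (copies q 2)) : s.pt ⟶ E₂ :=
    h.lift (s.π.app (some 0)) (s.π.app (some 1)) ((w s 0).trans (w s 1).symm)
  have hl₁ (s : Cone (copies q 2)) : l s ≫ ρ₁ = s.π.app (some 0) := h.lift_fst ..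
  have hl₂ (s : Cone (copies q 2)) : l s ≫ ρ₂ = s.π.app (some 1) := h.lift_snd ..
  have ht : IsLimit t :=
    { lift := l
      fac s := by
        rintro (_ | i)
        · change l s ≫ ρ₁ ≫ q = _
          rw [← Category.assoc, hl₁]
          exact w s 0
        · fin_cases i
          · exact hl₁ s
          · exact hl₂ s
      uniq s m hm := by
        apply h.hom_ext
        · exact (hm (some 0)).trans (hl₁ s).symm
        · exact (hm (some 1)).trans (hl₂ s).symm }
  refine (isLimitOfPreserves F ht).hom_ext ?_
  rintro (_ | i)
  · change f ≫ F.map (ρ₁ ≫ q) = g ≫ F.map (ρ₁ ≫ q)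
    rw [F.map_comp, ← Category.assoc, h₁, Category.assoc]
  · fin_cases i
    · exact h₁
    · exact h₂

/-! ### Splitting the total space of a differential bundle -/

namespace LinearAssignment

variable {C : Type u} [Category.{v} C] [CartesianMonoidalCategory C] [BraidedCategory C]
  [HasZeroMorphisms C] [IsUnital C] (𝓛 : LinearAssignment C)

section Splitting

variable {𝓛} {E X E₂ : C} {q : E ⟶ X} {ζ : X ⟶ E} {ρ₁ ρ₂ add : E₂ ⟶ E}
  {lam : E ⟶ E ⊗ 𝓛.L.obj E} {w : E₂ ⟶ E₂ ⊗ 𝓛.L.obj E₂}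

/-- The total space of a differential bundle is the product of the base and the kernel of
`L q`. -/
theorem isIso_lift_of_universal (hP : IsPullback ρ₁ ρ₂ q q) (hζ : ζ ≫ q = 𝟙 X)
    (hext : ∀ {W : C} {f g : W ⟶ E₂ ⊗ 𝓛.L.obj E₂},
      f ≫ (ρ₁ ⊗ₘ 𝓛.L.map ρ₁) = g ≫ (ρ₁ ⊗ₘ 𝓛.L.map ρ₁) →
      f ≫ (ρ₂ ⊗ₘ 𝓛.L.map ρ₂) = g ≫ (ρ₂ ⊗ₘ 𝓛.L.map ρ₂) → f = g)
    (hzero : ∀ {W : C} (f : W ⟶ E₂), f ≫ ρ₁ = f ≫ ρ₂ ≫ q ≫ ζ → f ≫ add = f ≫ ρ₂)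
    (hzero' : ∀ {W : C} (f : W ⟶ E₂), f ≫ ρ₂ = f ≫ ρ₁ ≫ q ≫ ζ → f ≫ add = f ≫ ρ₁)
    (hlam : lam ≫ fst _ _ = q ≫ ζ) (hlam' : lam ≫ (q ⊗ₘ 𝓛.L.map q) = q ≫ lift (𝟙 X) 0)
    (hw₁ : w ≫ (ρ₁ ⊗ₘ 𝓛.L.map ρ₁) = ρ₁ ≫ lam)
    (hw₂ : w ≫ (ρ₂ ⊗ₘ 𝓛.L.map ρ₂) = ρ₂ ≫ lift (𝟙 E) 0)
    (hU : IsPullback (w ≫ (add ⊗ₘ 𝓛.L.map add)) (ρ₁ ≫ q) (q ⊗ₘ 𝓛.L.map q) (lift (𝟙 X) 0))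
    {K : C} (k : E ⟶ K) (i : K ⟶ 𝓛.L.obj E) [Mono i] (hk : k ≫ i = lam ≫ snd _ _)
    (hi : i ≫ 𝓛.L.map q = 0) :
    IsIso (lift q k) := by
  -- The map `d` is `y ↦ (y, 0)`; along it the top side of the universal square restricts to the
  -- lift.
  let d : E ⟶ E₂ := hP.lift (𝟙 E) (q ≫ ζ) (by rw [Category.id_comp, Category.assoc, hζ,
    Category.comp_id])
  have hd₁ : d ≫ ρ₁ = 𝟙 E := hP.lift_fst ..
  have hd₂ : d ≫ ρ₂ = q ≫ ζ := hP.lift_snd ..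
  have hda : d ≫ add = 𝟙 E := by
    rw [hzero' d (by rw [hd₂, ← Category.assoc, hd₁, Category.id_comp]), hd₁]
  have hdw : d ≫ w = lam ≫ (d ⊗ₘ 𝓛.L.map d) := by
    apply hext
    · rw [Category.assoc, hw₁, ← Category.assoc, hd₁, Category.id_comp, Category.assoc,
        tensorHom_comp_tensorHom, ← 𝓛.L.map_comp, hd₁]
      simp
    · rw [Category.assoc, hw₂, ← Category.assoc, hd₂, Category.assoc lam,
        tensorHom_comp_tensorHom, ← 𝓛.L.map_comp, hd₂, 𝓛.L.map_comp, ← tensorHom_comp_tensorHom,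
        ← Category.assoc lam, hlam']
      ext <;> simp
  have hdlam : d ≫ w ≫ (add ⊗ₘ 𝓛.L.map add) = lam := by
    rw [← Category.assoc, hdw, Category.assoc, tensorHom_comp_tensorHom, ← 𝓛.L.map_comp, hda]
    simp
  -- The lift sits over the zero section, so this is `0 + y₂ = y₂`.
  have hwa : w ≫ fst _ _ ≫ add = ρ₂ := by
    have e₁ : w ≫ fst _ _ ≫ ρ₁ = ρ₁ ≫ q ≫ ζ := by
      have := hw₁ =≫ fst _ _
      simpa [hlam] using this
    have e₂ : w ≫ fst _ _ ≫ ρ₂ = ρ₂ := by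
      have := hw₂ =≫ fst _ _
      simpa using this
    rw [← Category.assoc, hzero, Category.assoc, e₂]
    rw [Category.assoc, e₁, Category.assoc, ← Category.assoc (fst _ _), ← Category.assoc w, e₂,
      ← Category.assoc, hP.w, Category.assoc]
  let a : X ⊗ K ⟶ E ⊗ 𝓛.L.obj E := lift (fst _ _ ≫ ζ) (snd _ _ ≫ i)
  -- Universality turns `(0_x, i κ)` into a pair over `x`; by `hwa` its second entry is zero, so it
  -- is `d` of its first entry, and that entry is the value of the inverse at `(x, κ)`.
  let t : X ⊗ K ⟶ E₂ := hU.lift a (fst _ _) (by ext <;> simp [a, hζ, hi])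
  have ht : t ≫ w ≫ (add ⊗ₘ 𝓛.L.map add) = a := hU.lift_fst ..
  have htq : t ≫ ρ₁ ≫ q = fst _ _ := hU.lift_snd ..
  have ht₂ : t ≫ ρ₂ = fst _ _ ≫ ζ := by
    have := ht =≫ fst _ _
    simpa [a, hwa] using this
  have htd : t = (t ≫ ρ₁) ≫ d := by
    apply hP.hom_ext
    · rw [Category.assoc, hd₁, Category.comp_id]
    · rw [Category.assoc, hd₂, ht₂, Category.assoc, ← Category.assoc ρ₁, ← Category.assoc t, htq]
  have htk : (t ≫ ρ₁) ≫ k = snd _ _ := by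
    rw [← cancel_mono i, Category.assoc, hk]
    have : (t ≫ ρ₁) ≫ lam = a := by rw [← hdlam, ← Category.assoc, ← htd, ht]
    rw [← Category.assoc, this, lift_snd]
  refine ⟨t ≫ ρ₁, ?_, ?_⟩
  · have : lift q k ≫ t = d := by
      apply hU.hom_ext
      · rw [Category.assoc, ht, hdlam]
        ext <;> simp [a, hlam, hk]
      · rw [Category.assoc, htq, lift_fst, ← Category.assoc, hd₁, Category.id_comp]
    rw [← Category.assoc, this, hd₁]
  · ext
    · simpa using htq
    · simpa using htk

end Splitting

end LinearAssignment

/-! ### Units of a linear assignment and the product bundle functors -/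

namespace LinearAssignment

variable {C : Type u} [Category.{v} C] [CartesianMonoidalCategory C] [BraidedCategory C]
  [HasZeroMorphisms C] [IsUnital C]

/-- A unit of a linear assignment: a natural transformation `X ⟶ L X` that agrees with `ν⁻¹` on
the image of `L` and is invertible on monoids. -/
structure Unit (𝓛 : LinearAssignment C) where
  app (X : C) : X ⟶ 𝓛.L.obj X
  naturality {X Y : C} (f : X ⟶ Y) : app X ≫ 𝓛.L.map f = f ≫ app Y
  ν_inv_app (X : C) : 𝓛.ν.inv.app X = app (𝓛.L.obj X)
  isIso_app (M : C) [MonObj M] : IsIso (app M)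

attribute [instance] Unit.isIso_app

namespace Unit

variable {𝓛 : LinearAssignment C} (e : 𝓛.Unit)

instance isMonHom_app (M : C) [MonObj M] : IsMonHom (e.app M) :=
  isMonHom_of_isUnital _

/-- Naturality of the unit at `e_M` itself gives `L(e_M) = e_{LM}` after cancelling the invertible
`e_M`. -/
theorem map_app (M : C) [MonObj M] : 𝓛.L.map (e.app M) = 𝓛.ν.inv.app M := by
  rw [← cancel_epi (e.app M), e.naturality, e.ν_inv_app]

theorem productLift_naturality {X X' M M' : C} (g : X ⟶ X') (f : M ⟶ M') :
    𝓛.productLift X (e.app M) ≫ ((g ⊗ₘ f) ⊗ₘ 𝓛.L.map (g ⊗ₘ f)) =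
      (g ⊗ₘ f) ≫ 𝓛.productLift X' (e.app M') := by
  simp only [productLift]
  apply CartesianMonoidalCategory.hom_ext
  · ext <;> simp
  · apply 𝓛.hom_ext <;> simp [e.naturality]

/-- By linearity the fibre component of `h`, followed by the monic `e_{M'}`, depends only on the
`M`-coordinate. So it vanishes on `X × 0` and is determined by its restriction to `M`. -/
theorem eq_tensorHom_of_linear {X X' M M' : C} [MonObj M'] (g : X ⟶ X')
    (h : X ⊗ M ⟶ X' ⊗ M') (hg : h ≫ fst X' M' = fst X M ≫ g)
    (hl : 𝓛.productLift X (e.app M) ≫ (h ⊗ₘ 𝓛.L.map h) = h ≫ 𝓛.productLift X' (e.app M')) :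
    h = g ⊗ₘ (quasiInr X M ≫ h ≫ snd X' M') := by
  have key := hl =≫ (snd _ _ ≫ 𝓛.L.map (snd X' M'))
  simp only [productLift, Category.assoc, lift_snd_assoc, tensorHom_snd_assoc,
    pairing_map_snd] at key
  have hz : quasiInl X M ≫ h ≫ snd X' M' = 0 := by
    rw [← cancel_mono (e.app M'), Category.assoc, Category.assoc, ← key, ← Category.assoc,
      comp_pairing]
    have : 𝓛.pairing (quasiInl X M ≫ (0 : X ⊗ M ⟶ 𝓛.L.obj X))
        (quasiInl X M ≫ snd X M ≫ e.app M) = 0 := by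
      apply 𝓛.hom_ext <;> simp [quasiInl]
    rw [this]
    simp
  apply CartesianMonoidalCategory.hom_ext
  · simpa using hg
  · apply hom_ext_quasiInj
    · rw [hz]
      simp [quasiInl]
    · simp [quasiInr]

/-- The differential bundle `X × M ⟶ X` of a commutative monoid `M`. -/
abbrev bundle (X : C) (M : CommMon C) : DifferentialBundleOver 𝓛.tangentStructure X :=
  𝓛.productDifferentialBundle X M.X (e.app M.X) (e.map_app M.X)

/-- The functor sending a commutative monoid `M` to the differential bundle `X × M ⟶ X`. -/
def bundleFunctor (X : C) : CommMon C ⥤ DifferentialBundleOver 𝓛.tangentStructure X where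
  obj M := e.bundle X M
  map {M N} f :=
    { hom := 𝟙 X ⊗ₘ (CommMon.forget C).map f
      proj := (tensorHom_fst _ _).trans (Category.comp_id _)
      lift := e.productLift_naturality (𝟙 X) ((CommMon.forget C).map f) }
  map_id M := DifferentialBundleOver.Hom.ext <| by
    change 𝟙 X ⊗ₘ (CommMon.forget C).map (𝟙 M) = 𝟙 (X ⊗ M.X)
    exact id_tensorHom_id X M.X
  map_comp {M N P} f g := DifferentialBundleOver.Hom.ext <| by
    change 𝟙 X ⊗ₘ (CommMon.forget C).map (f ≫ g) =
      (𝟙 X ⊗ₘ (CommMon.forget C).map f) ≫ (𝟙 X ⊗ₘ (CommMon.forget C).map g)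
    rw [Functor.map_comp, tensorHom_comp_tensorHom, Category.comp_id]

/-- The functor sending `(X, M)` to the differential bundle `X × M ⟶ X`. -/
def totalBundleFunctor : C × CommMon C ⥤ DifferentialBundle 𝓛.tangentStructure where
  obj P := ⟨P.1, e.bundle P.1 P.2⟩
  map {P Q} f :=
    { hom := f.1 ⊗ₘ (CommMon.forget C).map f.2
      base := f.1
      proj := tensorHom_fst _ _
      lift := e.productLift_naturality f.1 ((CommMon.forget C).map f.2) }
  map_id P := DifferentialBundle.Hom.ext
    (by
      change 𝟙 P.1 ⊗ₘ (CommMon.forget C).map (𝟙 P.2) = 𝟙 (P.1 ⊗ P.2.X)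
      exact id_tensorHom_id P.1 P.2.X) rfl
  map_comp {P Q R} f g := DifferentialBundle.Hom.ext
    (by
      change (f.1 ≫ g.1) ⊗ₘ (CommMon.forget C).map (f.2 ≫ g.2) =
        (f.1 ⊗ₘ (CommMon.forget C).map f.2) ≫ (g.1 ⊗ₘ (CommMon.forget C).map g.2)
      rw [Functor.map_comp, tensorHom_comp_tensorHom]) rfl

theorem quasiInr_tensorHom_snd {X X' M M' : C} (g : X ⟶ X') (f : M ⟶ M') :
    quasiInr X M ≫ (g ⊗ₘ f) ≫ snd X' M' = f := by
  simp [quasiInr]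

instance bundleFunctor_faithful (X : C) : (e.bundleFunctor X).Faithful where
  map_injective {M N} f f' h := by
    have h' : 𝟙 X ⊗ₘ (CommMon.forget C).map f = 𝟙 X ⊗ₘ (CommMon.forget C).map f' :=
      congrArg DifferentialBundleOver.Hom.hom h
    apply (CommMon.forget C).map_injective
    rw [← quasiInr_tensorHom_snd (𝟙 X) ((CommMon.forget C).map f), h', quasiInr_tensorHom_snd]

instance bundleFunctor_full (X : C) : (e.bundleFunctor X).Full where
  map_surjective {M N} h := by
    refine ⟨commMonHom (quasiInr X M.X ≫ h.hom ≫ snd X N.X), DifferentialBundleOver.Hom.ext ?_⟩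
    exact (e.eq_tensorHom_of_linear (𝟙 X) h.hom (h.proj.trans (Category.comp_id _).symm)
      h.lift).symm

instance totalBundleFunctor_faithful : e.totalBundleFunctor.Faithful where
  map_injective {P Q} f f' h := by
    have h₁ : f.1 = f'.1 := congrArg DifferentialBundle.Hom.base h
    have h₂ : f.1 ⊗ₘ (CommMon.forget C).map f.2 = f'.1 ⊗ₘ (CommMon.forget C).map f'.2 :=
      congrArg DifferentialBundle.Hom.hom h
    refine Prod.ext h₁ ((CommMon.forget C).map_injective ?_)
    rw [← quasiInr_tensorHom_snd f.1 ((CommMon.forget C).map f.2), h₂, quasiInr_tensorHom_snd]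

instance totalBundleFunctor_full : e.totalBundleFunctor.Full where
  map_surjective {P Q} h := by
    refine ⟨(h.base, commMonHom (quasiInr P.1 P.2.X ≫ h.hom ≫ snd Q.1 Q.2.X)),
      DifferentialBundle.Hom.ext ?_ rfl⟩
    exact (e.eq_tensorHom_of_linear h.base h.hom h.proj h.lift).symm

end Unit

end LinearAssignment

/-! ### Every differential bundle is linearly a product bundle -/

namespace LinearAssignment

variable {C : Type u} [Category.{v} C] [CartesianMonoidalCategory C] [BraidedCategory C]
  [HasZeroMorphisms C] [IsUnital C] {𝓛 : LinearAssignment C}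

/-- The lift of a differential bundle, as a morphism `E ⟶ E × L E`. -/
def bundleLift {X : C} (A : DifferentialBundleOver 𝓛.tangentStructure X) :
    A.E ⟶ A.E ⊗ 𝓛.L.obj A.E := A.lam

section

variable {X : C} (A : DifferentialBundleOver 𝓛.tangentStructure X)

theorem bundleLift_fst : bundleLift A ≫ fst _ _ = A.q ≫ A.zero := A.lift_additive.proj

theorem bundleLift_map_proj :
    bundleLift A ≫ (A.q ⊗ₘ 𝓛.L.map A.q) = A.q ≫ lift (𝟙 X) 0 := by
  rw [← 𝓛.zero_eq_zero X X]
  exact A.lift_additive_zero.proj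

theorem bundleLift_snd_map_proj :
    (bundleLift A ≫ snd _ _) ≫ 𝓛.L.map A.q = 0 := by
  simpa using bundleLift_map_proj A =≫ snd _ _

theorem zero_bundleLift : A.zero ≫ bundleLift A = A.zero ≫ lift (𝟙 A.E) 0 := by
  rw [← 𝓛.zero_eq_zero A.E A.E]
  exact A.lift_additive.zero

theorem bundleLift_coassoc :
    bundleLift A ≫ (bundleLift A ⊗ₘ 𝓛.L.map (bundleLift A)) = bundleLift A ≫ 𝓛.vlift A.E :=
  A.lift_coassoc

theorem bundleLift_snd_map_snd :
    (bundleLift A ≫ snd _ _) ≫ 𝓛.L.map (bundleLift A ≫ snd _ _) =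
      (bundleLift A ≫ snd _ _) ≫ 𝓛.ν.inv.app A.E := by
  have h := bundleLift_coassoc A =≫ (snd _ _ ≫ 𝓛.L.map (snd _ _))
  simpa [vlift_eq, productLift] using h

/-- Of the preservation conditions, only `T` itself on the pullback of two copies is needed,
together with universality at `m = 0`. -/
theorem isIso_lift_of_differentialBundle {K : C} (k : A.E ⟶ K) (i : K ⟶ 𝓛.L.obj A.E) [Mono i]
    (hk : k ≫ i = bundleLift A ≫ snd _ _) (hi : i ≫ 𝓛.L.map A.q = 0) : IsIso (lift A.q k) := by
  obtain ⟨w, hw₁, hw₂, hU⟩ := A.lift_universal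
  have hP := A.isAdditiveBundle.isPullback
  have hζ : A.zero ≫ A.q = 𝟙 X := A.isAdditiveBundle.zero_proj
  have : PreservesLimit (copies A.q 2) (iter 𝓛.tangentStructure.T 1) := A.preservesPowers 1 2
  refine isIso_lift_of_universal (add := A.add) (w := w) hP hζ ?_ ?_ ?_ (bundleLift_fst A)
    (bundleLift_map_proj A) hw₁ ?_ ?_ k i hk hi
  · intro W f g h₁ h₂
    exact map_hom_ext_of_preservesLimit_copies hP (iter 𝓛.tangentStructure.T 1) h₁ h₂
  · intro W f hf
    refine Eq.trans (congrArg (· ≫ A.add) ?_) (A.isAdditiveBundle.zero_add (f ≫ A.ρ₂))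
    apply hP.hom_ext
    · rw [hf, IsPullback.lift_fst, Category.assoc]
    · rw [IsPullback.lift_snd]
  · intro W f hf
    refine Eq.trans (congrArg (· ≫ A.add) ?_) (A.isAdditiveBundle.add_zero (f ≫ A.ρ₁))
    apply hP.hom_ext
    · rw [IsPullback.lift_fst]
    · rw [hf, IsPullback.lift_snd, Category.assoc]
  · rw [← 𝓛.zero_eq_zero A.E A.E]
    exact hw₂
  · rw [← 𝓛.zero_eq_zero X X]
    exact hU 0

end

namespace Unit

/-- The kernel of `f : L E ⟶ L X` is a commutative monoid. -/
theorem exists_commMon_kernel {E X : C} (f : 𝓛.L.obj E ⟶ 𝓛.L.obj X) :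
    ∃ K : CommMon C, ∃ i : K.X ⟶ 𝓛.L.obj E, Mono i ∧ i ≫ f = 0 ∧
      ∀ {W : C} (g : W ⟶ 𝓛.L.obj E), g ≫ f = 0 → ∃ k : W ⟶ K.X, k ≫ i = g := by
  have : IsMonHom f := isMonHom_of_isUnital f
  let i := kernel.ι f
  have hi : i ≫ f = 0 := kernel.condition f
  -- As `f` is additive, the sum of two elements of its kernel is sent to `0 + 0 = 0`.
  let m : kernel f ⊗ kernel f ⟶ kernel f := kernel.lift f ((i ⊗ₘ i) ≫ μ) (by
    rw [Category.assoc, IsMonHom.mul_hom, tensorHom_comp_tensorHom_assoc, hi]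
    apply hom_ext_quasiInj <;> simp [quasiInl, quasiInr, lift_zero_left_comp_mul])
  have hm : m ≫ i = (i ⊗ₘ i) ≫ μ := kernel.lift_ι ..
  refine ⟨commMonOfMul m ?_ ?_, i, (inferInstance : Mono (kernel.ι f)), hi,
    fun g hg => ⟨kernel.lift f g hg, kernel.lift_ι ..⟩⟩
  · rw [← cancel_mono i, Category.assoc, hm, ← Category.assoc, quasiInl_tensorHom,
      Category.assoc, quasiInl_mul, Category.id_comp, Category.comp_id]
  · rw [← cancel_mono i, Category.assoc, hm, ← Category.assoc, quasiInr_tensorHom,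
      Category.assoc, quasiInr_mul, Category.id_comp, Category.comp_id]

/-- Up to the invertible units at the monoids `M` and `LE`, the map `L i` is `i` itself. -/
theorem mono_map_of_mono (e : 𝓛.Unit) {E : C} {M : C} [MonObj M] (i : M ⟶ 𝓛.L.obj E) [Mono i] :
    Mono (𝓛.L.map i) := by
  have : 𝓛.L.map i = inv (e.app M) ≫ i ≫ e.app (𝓛.L.obj E) := by
    rw [← e.naturality, IsIso.inv_hom_id_assoc]
  rw [this]
  infer_instance

/-- A differential bundle over `X` is linearly isomorphic to a product bundle. -/
theorem exists_linear_iso (e : 𝓛.Unit) {X : C}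
    (A : DifferentialBundleOver 𝓛.tangentStructure X) :
    ∃ (K : CommMon C) (θ : A.E ⟶ X ⊗ K.X), IsIso θ ∧
    θ ≫ fst X K.X = A.q ∧
      bundleLift A ≫ (θ ⊗ₘ 𝓛.L.map θ) = θ ≫ 𝓛.productLift X (e.app K.X) := by
  obtain ⟨K, i, hmono, hi, hK⟩ := exists_commMon_kernel (𝓛.L.map A.q)
  obtain ⟨k, hk⟩ := hK (bundleLift A ≫ snd _ _) (bundleLift_snd_map_proj A)
  refine ⟨K, lift A.q k, isIso_lift_of_differentialBundle A k i hk hi, lift_fst .., ?_⟩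
  have hζ : A.zero ≫ A.q = 𝟙 X := A.isAdditiveBundle.zero_proj
  have hζk : A.zero ≫ k = 0 := by
    rw [← cancel_mono i, Category.assoc, hk, ← Category.assoc, zero_bundleLift]
    simp
  have := e.mono_map_of_mono i
  -- After the monomorphism `L i`, linearity in the fibre becomes the last coordinate of
  -- coassociativity.
  have hkk : (bundleLift A ≫ snd _ _) ≫ 𝓛.L.map k = k ≫ e.app K.X := by
    rw [← cancel_mono (𝓛.L.map i), Category.assoc, ← 𝓛.L.map_comp, hk, bundleLift_snd_map_snd,
      Category.assoc k, e.naturality, ← Category.assoc k, hk, e.ν_inv_app]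
  apply CartesianMonoidalCategory.hom_ext
  · rw [Category.assoc, tensorHom_fst, ← Category.assoc, bundleLift_fst]
    ext
    · simp [productLift, hζ]
    · simp [productLift, hζk]
  · rw [Category.assoc, tensorHom_snd, ← Category.assoc]
    apply 𝓛.hom_ext
    · simpa [productLift] using bundleLift_snd_map_proj A
    · simpa [productLift] using hkk

end Unit

end LinearAssignment

/-! ### The equivalences -/

namespace LinearAssignment

variable {C : Type u} [Category.{v} C] [CartesianMonoidalCategory C] [BraidedCategory C]
  [HasZeroMorphisms C] [IsUnital C] {𝓛 : LinearAssignment C}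

/-- The inverse of a linear isomorphism is linear. -/
theorem inv_linear {E E' : C} (θ : E ⟶ E') [IsIso θ] {l : E ⟶ E ⊗ 𝓛.L.obj E}
    {l' : E' ⟶ E' ⊗ 𝓛.L.obj E'} (h : l ≫ (θ ⊗ₘ 𝓛.L.map θ) = θ ≫ l') :
    l' ≫ (inv θ ⊗ₘ 𝓛.L.map (inv θ)) = inv θ ≫ l := by
  rw [IsIso.eq_inv_comp, ← Category.assoc, ← h, Category.assoc, tensorHom_comp_tensorHom,
    ← 𝓛.L.map_comp, IsIso.hom_inv_id]
  simp

namespace Unit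

variable (e : 𝓛.Unit)

instance bundleFunctor_essSurj (X : C) : (e.bundleFunctor X).EssSurj where
  mem_essImage A := by
    obtain ⟨K, θ, _, hθ, hl⟩ := e.exists_linear_iso A
    let φ : X ⊗ K.X ⟶ A.E := inv θ
    let f : A ⟶ (e.bundleFunctor X).obj K := { hom := θ, proj := hθ, lift := hl }
    let g : (e.bundleFunctor X).obj K ⟶ A :=
      { hom := φ
        proj := (IsIso.inv_comp_eq θ).2 hθ.symm
        lift := inv_linear θ hl }
    exact ⟨K, ⟨⟨g, f, DifferentialBundleOver.Hom.ext (IsIso.inv_hom_id θ),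
      DifferentialBundleOver.Hom.ext (IsIso.hom_inv_id θ)⟩⟩⟩

instance totalBundleFunctor_essSurj : e.totalBundleFunctor.EssSurj where
  mem_essImage A := by
    obtain ⟨K, θ, _, hθ, hl⟩ := e.exists_linear_iso A.bundle
    let φ : A.base ⊗ K.X ⟶ A.bundle.E := inv θ
    let f : A ⟶ e.totalBundleFunctor.obj (A.base, K) :=
      { hom := θ
        base := 𝟙 A.base
        proj := hθ.trans (Category.comp_id _).symm
        lift := hl }
    let g : e.totalBundleFunctor.obj (A.base, K) ⟶ A :=
      { hom := φ
        base := 𝟙 A.base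
        proj := ((IsIso.inv_comp_eq θ).2 hθ.symm).trans (Category.comp_id _).symm
        lift := inv_linear θ hl }
    exact ⟨(A.base, K), ⟨⟨g, f,
      DifferentialBundle.Hom.ext (IsIso.inv_hom_id θ) (Category.id_comp _),
      DifferentialBundle.Hom.ext (IsIso.hom_inv_id θ) (Category.id_comp _)⟩⟩⟩

/-- Commutative monoids are equivalent to differential bundles over `X`. -/
def bundleEquivalence (X : C) : CommMon C ≌ DifferentialBundleOver 𝓛.tangentStructure X :=
  have : (e.bundleFunctor X).IsEquivalence := { }
  (e.bundleFunctor X).asEquivalence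

/-- Pairs of an object and a commutative monoid are equivalent to differential bundles. -/
def totalBundleEquivalence : C × CommMon C ≌ DifferentialBundle 𝓛.tangentStructure :=
  have : e.totalBundleFunctor.IsEquivalence := { }
  e.totalBundleFunctor.asEquivalence

/-- The unit of a linear reflector. -/
def ofReflector {R : C ⥤ CommMon C} (adj : R ⊣ CommMon.forget C) (h : IsLinearReflector adj) :
    (LinearAssignment.ofReflector adj h).Unit where
  app X := adj.unit.app X
  naturality f := (adj.unit.naturality f).symm
  ν_inv_app X := by
    -- Fullness makes the counit invertible, and the triangle identity identifies the unit with its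
    -- inverse.
    have := h.full
    let i := (CommMon.forget C).mapIso (asIso (adj.counit.app (R.obj X)))
    have hi : adj.unit.app ((CommMon.forget C).obj (R.obj X)) ≫ i.hom = 𝟙 _ :=
      adj.right_triangle_components (R.obj X)
    exact (i.comp_hom_eq_id.1 hi).symm
  isIso_app M _ := by
    have := h.full
    have := isCommMonObj_of_isUnital M
    let N : CommMon C := { X := M }
    have hi : adj.unit.app ((CommMon.forget C).obj N) ≫
        (CommMon.forget C).map (adj.counit.app N) = 𝟙 _ := adj.right_triangle_components N
    have hN : IsIso (adj.unit.app ((CommMon.forget C).obj N)) :=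
      IsIso.of_isIso_fac_right hi
    exact hN

end Unit

end LinearAssignment

end UnitalTangent

end

theorem mainTheorem9 {C : Type u} [Category.{v} C] [CartesianMonoidalCategory C]
    [BraidedCategory C] [HasZeroMorphisms C] [UnitalTangent.IsUnital C] [Regular C]
    [HasFiniteColimits C] :
    (CommMon.forget C).IsRightAdjoint ∧
    ∀ (CMon : C ⥤ CommMon C) (adj : CMon ⊣ CommMon.forget C),
      (∀ X : C, ∃ (π : X ⊗ X ⟶ (CMon.obj X).X)
        (w : UnitalTangent.quasiInl X X ≫ π = UnitalTangent.quasiInr X X ≫ π),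
        Nonempty (IsColimit (Cofork.ofπ π w)) ∧
          UnitalTangent.quasiInl X X ≫ π = adj.unit.app X) ∧
      ∃ (h : UnitalTangent.IsLinearReflector adj) (𝕋 : UnitalTangent.TangentStructure C),
        𝕋.toTangentData = (UnitalTangent.LinearAssignment.ofReflector adj h).tangentData ∧
        𝕋.IsCartesian ∧
        Nonempty (UnitalTangent.DifferentialBundle 𝕋 ≌ C × CommMon C) ∧
        ∀ X : C, Nonempty (UnitalTangent.DifferentialBundleOver 𝕋 X ≌ CommMon C)
 := by
  refine ⟨UnitalTangent.forget_isRightAdjoint, fun CMon adj =>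
    ⟨UnitalTangent.exists_isColimit_unit adj, UnitalTangent.isLinearReflector adj, ?_⟩⟩
  let e := UnitalTangent.LinearAssignment.Unit.ofReflector adj (UnitalTangent.isLinearReflector adj)
  exact ⟨(UnitalTangent.LinearAssignment.ofReflector adj _).tangentStructure, rfl,
    UnitalTangent.LinearAssignment.tangentStructure_isCartesian _,
    ⟨e.totalBundleEquivalence.symm⟩, fun X => ⟨(e.bundleEquivalence X).symm⟩⟩
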